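/- Let $L=\{E_n : n\in\omega\}$ be the language with countably many binary relation symbols, and let $\mathrm{REF}(\mathrm{bin})$ be the first-order $L$-theory asserting that each $E_n$ is an equivalence relation, that $E_0$ has a single class, that each $E_{n+1}$ refines $E_n$, and that each $E_n$-class is partitioned into exactly two $E_{n+1}$-classes. Let $\mathrm{Mod}(\mathrm{REF}(\mathrm{bin}))$ be the space of models of $\mathrm{REF}(\mathrm{bin})$ with universe $\omega$, with the logic topology (in which, for all $n,a,b\in\omega$, the truth value of $E_n(a,b)$ is a clopen condition, and which is generated by these conditions). For $L$-structures $M,N$ and an ordinal $\alpha$, finite tuples $\bar a\in M^k$, $\bar b\in N^k$ are $\alpha$-equivalent, written $(M,\bar a)\equiv_\alpha(N,\bar b)$, if they satisfy the same first-order formulas and, for every $\beta<\alpha$: for every $c\in M$ there is $d\in N$ with $(M,\bar a c)\equiv_\beta(N,\bar b d)$, and for every $d\in N$ there is $c\in M$ with $(M,\bar a c)\equiv_\beta(N,\bar b d)$. Write $M\equiv_\alpha N$ when this holds for the empty tuples. **Theorem.** The isomorphism relation on $\mathrm{Mod}(\mathrm{REF}(\mathrm{bin}))$ is not a Borel subset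 of $\mathrm{Mod}(\mathrm{REF}(\mathrm{bin}))\times\mathrm{Mod}(\mathrm{REF}(\mathrm{bin}))$. Moreover, for every $\alpha<\omega_1$ there are countable models $M,N$ of $\mathrm{REF}(\mathrm{bin})$ (with universe $\omega$) such that $M\equiv_\alpha N$ but $M\not\cong N$. -/

import Mathlib

open scoped FirstOrder

namespace RefBin

/-- The relation symbols of the language `{E n : n ∈ ℕ}`, each of them binary. -/
inductive Rel : ℕ → Type
  | E (n : ℕ) : Rel 2

/-- The language `{E n : n ∈ ℕ}` of countably many binary relation symbols. -/
def lang : FirstOrder.Language.{0, 0} := ⟨fun _ => Empty, Rel⟩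

/-- The symbol `E n`. -/
def sym (n : ℕ) : lang.Relations 2 := Rel.E n

/-- The atomic formula `E n x_i x_j`. -/
def atom {k : ℕ} (n : ℕ) (i j : Fin k) : lang.BoundedFormula Empty k :=
  (sym n).boundedFormula₂ (&i) (&j)

/-- `E 0` consists of a single class: `∀ x y, E 0 x y`. -/
def trivialAxiom : lang.Sentence := ∀' ∀' (atom 0 0 1)

/-- `E (n + 1)` refines `E n`: `∀ x y, E (n + 1) x y → E n x y`. -/
def refineAxiom (n : ℕ) : lang.Sentence := ∀' ∀' (atom (n + 1) 0 1 ⟹ atom n 0 1)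

/-- Every `E n`-class is the union of exactly two `E (n + 1)`-classes:
`∀ x, ∃ y, E n x y ∧ ¬ E (n + 1) x y ∧ ∀ z, E n x z → E (n + 1) x z ∨ E (n + 1) y z`. -/
def splitAxiom (n : ℕ) : lang.Sentence :=
  ∀' ∃' (atom n 0 1 ⊓ (∼(atom (n + 1) 0 1) ⊓
    ∀' (atom n 0 2 ⟹ (atom (n + 1) 0 2 ⊔ atom (n + 1) 1 2))))

/-- The first-order theory REF(bin) of binary splitting, refining equivalence relations. -/
def REFbin : lang.Theory :=
  Set.range (fun n => (sym n).reflexive) ∪ Set.range (fun n => (sym n).symmetric) ∪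
    Set.range (fun n => (sym n).transitive) ∪ {trivialAxiom} ∪
    Set.range refineAxiom ∪ Set.range splitAxiom

end RefBin

namespace CountableModels

universe u v

/-- The space `X_L` of `L`-structures with universe `ℕ`. -/
def StructureSpace (L : FirstOrder.Language.{u, v}) : Type (max u v) := L.Structure ℕ

/-- The logic topology on `X_L`: the truth value of each atomic fact about given natural numbers
is a clopen condition. -/
instance (L : FirstOrder.Language.{u, v}) : TopologicalSpace (StructureSpace L) :=
  TopologicalSpace.generateFrom
    ({U | ∃ (n : ℕ) (R : L.Relations n) (x : Fin n → ℕ),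
        U = {M : StructureSpace L | @FirstOrder.Language.Structure.RelMap L ℕ M n R x}} ∪
      {U | ∃ (n : ℕ) (R : L.Relations n) (x : Fin n → ℕ),
        U = {M : StructureSpace L | ¬ @FirstOrder.Language.Structure.RelMap L ℕ M n R x}} ∪
      {U | ∃ (n : ℕ) (f : L.Functions n) (x : Fin n → ℕ) (y : ℕ),
        U = {M : StructureSpace L | @FirstOrder.Language.Structure.funMap L ℕ M n f x = y}})

/-- `Mod(T)`, the set of models of `T` with universe `ℕ`. As a subtype it carries the subspace
topology. -/
def ModelSpace {L : FirstOrder.Language.{u, v}} (T : L.Theory) : Set (StructureSpace L) :=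
  {M | @FirstOrder.Language.Theory.Model L ℕ M T}

/-- Isomorphism of `L`-structures with universe `ℕ`. -/
def Iso {L : FirstOrder.Language.{u, v}} (M N : StructureSpace L) : Prop :=
  Nonempty (@FirstOrder.Language.Equiv L ℕ ℕ M N)

/-- Isomorphism on `Mod(T)` is Borel: it is a Borel subset of `Mod(T) × Mod(T)` (the Borel
σ-algebra being generated by the product topology). -/
def IsomorphismIsBorel {L : FirstOrder.Language.{u, v}} (T : L.Theory) : Prop :=
  @MeasurableSet (ModelSpace T × ModelSpace T) (borel (ModelSpace T × ModelSpace T))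
    {p : ModelSpace T × ModelSpace T | Iso p.1.1 p.2.1}

/-- The map `a i ↦ b i` is partial elementary from `M` to `N`. -/
def PartialElementary {L : FirstOrder.Language.{u, v}} (M N : StructureSpace L) {n : ℕ}
    (a b : Fin n → ℕ) : Prop :=
  ∀ φ : L.Formula (Fin n),
    @FirstOrder.Language.Formula.Realize L ℕ M (Fin n) φ a ↔
      @FirstOrder.Language.Formula.Realize L ℕ N (Fin n) φ b

/-- Player II wins the following game from the position `(a, b)`, with the clock at `α`. On each
turn Player I lowers the clock to some ordinal `β < α` and picks an element of `M` or of `N`;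
Player II answers with an element of the other structure; and Player II has to keep the map from
the chosen elements of `M` to the chosen elements of `N` partial elementary. -/
def PlayerTwoWins {L : FirstOrder.Language.{u, v}} (M N : StructureSpace L)
    (α : Ordinal.{0}) {n : ℕ} (a b : Fin n → ℕ) : Prop :=
  PartialElementary M N a b ∧ ∀ β : Ordinal.{0}, β < α →
    (∀ c : ℕ, ∃ d : ℕ, PlayerTwoWins M N β (Fin.snoc a c : Fin (n + 1) → ℕ) (Fin.snoc b d)) ∧
    (∀ d : ℕ, ∃ c : ℕ, PlayerTwoWins M N β (Fin.snoc a c : Fin (n + 1) → ℕ) (Fin.snoc b d))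
termination_by α

/-- `M ≡_α N`: Player II wins the game of length `α` from the empty position. -/
def EquivUpTo {L : FirstOrder.Language.{u, v}} (α : Ordinal.{0}) (M N : StructureSpace L) : Prop :=
  PlayerTwoWins M N α (Fin.elim0 : Fin 0 → ℕ) Fin.elim0

end CountableModels

/-! Non-Borelness follows from the second claim once it is known that Borel isomorphism on `Mod(T)`
is implied by `≡_α` for a single countable `α` (`IsomorphismIsBorel.exists_level`). This is shown by
Vaught transforms. For a Borel set `A` of pairs, consider the statement "for generic injections `h`
extending `g ↾ n`, `(M, h ∗ N) ∈ A`". By induction on `A`, its truth depends only on the `≡_α`-type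
of `(N, g ↾ n)`, for some countable `α` (`vaughtInvariant_of_borel`). A generic injection is a
permutation. So if `A` traces isomorphism and `M ≡_α N`, then `(M, h ∗ M) ∈ A` for generic `h` gives
`(M, h ∗ N) ∈ A` for generic `h`, whence `M ≅ N`.

For the second claim, a model is coded by a coloured tree, a multiplicity function on the Cantor
space whose support is countable and dense. An isomorphism of models induces an isometry preserving
multiplicities. By quantifier elimination, partial elementarity only concerns equality and the
levels at which branches split, so the game reduces to the relation `Sim` on trees.

Inequivalent trees that are `Sim α` are built by induction on `α`. Given pairs `P n`, `Q n` at
levels `s n` eventually above each `γ < α`, hang `P n` or `Q n` beside every `n`-th edge of the full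
binary tree according to the label of the edge, and realise as branches of that tree either a dense
set `Z` or another dense set `Z'`. Isometries must respect the labels because `P n` does not embed
in `Q n`; hence they fix all branches of the full tree and detect `Z ≠ Z'` (`not_isEmb_ramify`). In
the game at level `γ < α` the labels are invisible from some depth on, so a branch in `Z` can be
answered by a nearby branch in `Z'` (`sim_ramify`). -/

namespace CountableModels

open FirstOrder Topology Filter Ordinal

/-! ### Baire category in the space of injections. -/

/-- The sequences `x` and `y` agree in their first `n` entries. -/
def Agree {A : Type*} (n : ℕ) (x y : ℕ → A) : Prop := ∀ k < n, x k = y k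

/-- The space of injective maps from `ℕ` to `ℕ`. -/
abbrev Inj : Type := {g : ℕ → ℕ // Function.Injective g}

theorem isClosed_injective : IsClosed {g : ℕ → ℕ | Function.Injective g} := by
  have h : {g : ℕ → ℕ | Function.Injective g} =
      ⋂ (i : ℕ) (j : ℕ) (_ : i ≠ j), {g : ℕ → ℕ | g i ≠ g j} := by
    ext g
    simp only [Set.mem_ofPred_eq, Set.mem_iInter]
    exact ⟨fun h i j hij => h.ne hij, fun h i j hij => by_contra fun hne => h i j hne hij⟩
  rw [h]
  refine isClosed_iInter fun i => isClosed_iInter fun j => isClosed_iInter fun _ => ?_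
  have : Continuous fun g : ℕ → ℕ => (g i, g j) := by fun_prop
  exact (isClosed_discrete {p : ℕ × ℕ | p.1 ≠ p.2}).preimage this

instance : BaireSpace Inj := by
  have : PolishSpace Inj := isClosed_injective.polishSpace
  infer_instance

theorem isOpen_agree (n : ℕ) (g : ℕ → ℕ) : IsOpen {h : Inj | Agree n h.1 g} :=
  (PiNat.isOpen_cylinder (fun _ => ℕ) g n).preimage continuous_subtype_val

theorem Agree.mono {A : Type*} {m n : ℕ} (h : m ≤ n) {x y : ℕ → A} (hxy : Agree n x y) :
    Agree m x y :=
  fun k hk => hxy k (hk.trans_le h)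

theorem Agree.symm {A : Type*} {n : ℕ} {x y : ℕ → A} (h : Agree n x y) : Agree n y x :=
  fun k hk => (h k hk).symm

theorem Agree.trans {A : Type*} {n : ℕ} {x y z : ℕ → A} (h : Agree n x y) (h' : Agree n y z) :
    Agree n x z :=
  fun k hk => (h k hk).trans (h' k hk)

theorem Agree.refl {A : Type*} (n : ℕ) (x : ℕ → A) : Agree n x x := fun _ _ => rfl

theorem exists_agree_subset {U : Set Inj} (hU : IsOpen U) {g : Inj} (hg : g ∈ U) :
    ∃ n, ∀ h : Inj, Agree n h.1 g.1 → h ∈ U := by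
  obtain ⟨V, hV, rfl⟩ := isOpen_induced_iff.1 hU
  obtain ⟨_, ⟨x, n, rfl⟩, hx, hs⟩ :=
    (PiNat.isTopologicalBasis_cylinders fun _ => ℕ).exists_subset_of_mem_open
      (show g.1 ∈ V from hg) hV
  refine ⟨n, fun h hh => hs fun i hi => (hh i hi).trans (hx i hi)⟩

theorem exists_inj_agree {n : ℕ} {f : ℕ → ℕ} (hf : ∀ i < n, ∀ j < n, f i = f j → i = j) :
    ∃ g : Inj, Agree n g.1 f := by
  -- `B` bounds the first `n` values, so the tail `B + 1 + i` is injective and avoids them.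
  let B := ∑ i ∈ Finset.range n, f i
  have hB : ∀ i < n, f i ≤ B := fun i hi =>
    Finset.single_le_sum (f := f) (fun _ _ => Nat.zero_le _) (Finset.mem_range.2 hi)
  refine ⟨⟨fun i => if i < n then f i else B + 1 + i, fun i j hij => ?_⟩, fun i hi => if_pos hi⟩
  by_cases hi : i < n <;> by_cases hj : j < n <;> simp only [hi, hj, if_true, if_false] at hij
  · exact hf i hi j hj hij
  · have := hB i hi; omega
  · have := hB j hj; omega
  · omega

/-- Hitting `m` is an open condition, and a dense one: a finite injective sequence missing `m` can
take `m` as its next value. There are countably many `m`. -/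
theorem eventually_surjective_residual :
    ∀ᶠ g in residual Inj, Function.Surjective g.1 := by
  have : ∀ m : ℕ, ∀ᶠ g in residual Inj, ∃ i, g.1 i = m := by
    intro m
    have ho : IsOpen {g : Inj | ∃ i, g.1 i = m} := by
      have : {g : Inj | ∃ i, g.1 i = m} = ⋃ i, (fun g : Inj => g.1 i) ⁻¹' {m} := by
        ext; simp
      rw [this]
      exact isOpen_iUnion fun i =>
        (isOpen_discrete _).preimage ((continuous_apply i).comp continuous_subtype_val)
    refine residual_of_dense_open ho ?_
    rw [dense_iff_inter_open]
    rintro U hU ⟨g, hg⟩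
    obtain ⟨n, hn⟩ := exists_agree_subset hU hg
    by_cases hm : ∃ i < n, g.1 i = m
    · obtain ⟨i, -, hi⟩ := hm
      exact ⟨g, hg, i, hi⟩
    · push Not at hm
      obtain ⟨h, hh⟩ := exists_inj_agree (n := n + 1) (f := fun i => if i < n then g.1 i else m) (by
        intro i hi j hj hij
        by_cases hi' : i < n <;> by_cases hj' : j < n <;>
          simp only [hi', hj', if_true, if_false] at hij
        · exact g.2 hij
        · exact absurd hij (hm i hi')
        · exact absurd hij.symm (hm j hj')
        · omega)
      refine ⟨h, hn h fun i hi => ?_, n, ?_⟩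
      · rw [hh i (by omega)]; simp [hi]
      · rw [hh n (by omega)]; simp
  have := eventually_countable_forall.2 this
  filter_upwards [this] with g hg m using hg m

theorem exists_of_eventually_agree (g : Inj) (n : ℕ) {p : Inj → Prop}
    (h : ∀ᶠ h in residual Inj, Agree n h.1 g.1 → p h) : ∃ h : Inj, Agree n h.1 g.1 ∧ p h := by
  obtain ⟨x, hx, hx'⟩ :=
    (dense_of_mem_residual h).inter_open_nonempty _ (isOpen_agree n g.1) ⟨g, Agree.refl _ _⟩
  exact ⟨x, hx, hx' hx⟩

/-- Negation of the category quantifier. A set with the Baire property equals an open set up to a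
meagre set, so if it is not meagre in a cylinder, it is comeagre in some smaller cylinder. -/
theorem forall_generic_not_iff {S : Set Inj} (hS : BaireMeasurableSet S) (g : Inj) (n : ℕ) :
    (∀ᶠ h in residual Inj, Agree n h.1 g.1 → h ∉ S) ↔
      ∀ (m : ℕ) (c : Inj), n ≤ m → Agree n c.1 g.1 →
        ¬ ∀ᶠ h in residual Inj, Agree m h.1 c.1 → h ∈ S := by
  constructor
  · intro H m c hnm hc H'
    obtain ⟨x, hx, h1, h2⟩ := exists_of_eventually_agree c m (p := fun h => h ∉ S ∧ h ∈ S) (by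
      filter_upwards [H, H'] with h h1 h2 h3
      exact ⟨h1 ((h3.mono hnm).trans hc), h2 h3⟩)
    exact h1 h2
  · intro H
    obtain ⟨U, hU, hSU⟩ := hS.residualEq_isOpen
    have hSU' : ∀ᶠ h in residual Inj, h ∈ S ↔ h ∈ U := by
      filter_upwards [hSU] with h hh
      exact iff_of_eq hh
    filter_upwards [hSU'] with h hh hag hhS
    obtain ⟨k, hk⟩ := exists_agree_subset hU (hh.1 hhS)
    refine H (max n k) h (le_max_left _ _) hag ?_
    filter_upwards [hSU'] with x hx hxh
    exact hx.2 (hk x (hxh.mono (le_max_right _ _)))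

/-! ### The game and its finite extensions. -/

section Game

universe u v
variable {L : FirstOrder.Language.{u, v}} {M N N' : StructureSpace L}

theorem PlayerTwoWins.mono {α β : Ordinal.{0}} {n : ℕ} {a b : Fin n → ℕ} (h : β ≤ α)
    (H : PlayerTwoWins M N α a b) : PlayerTwoWins M N β a b := by
  rw [PlayerTwoWins] at H ⊢
  exact ⟨H.1, fun γ hγ => H.2 γ (hγ.trans_le h)⟩

theorem PlayerTwoWins.partialElementary {α : Ordinal.{0}} {n : ℕ} {a b : Fin n → ℕ}
    (H : PlayerTwoWins M N α a b) : PartialElementary M N a b := by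
  rw [PlayerTwoWins] at H
  exact H.1

theorem PlayerTwoWins.symm {α : Ordinal.{0}} {n : ℕ} {a b : Fin n → ℕ}
    (H : PlayerTwoWins M N α a b) : PlayerTwoWins N M α b a := by
  induction α using WellFoundedLT.induction generalizing n with
  | _ α ih =>
    rw [PlayerTwoWins] at H ⊢
    refine ⟨fun φ => (H.1 φ).symm, fun β hβ => ⟨fun c => ?_, fun d => ?_⟩⟩
    · obtain ⟨d, hd⟩ := (H.2 β hβ).2 c
      exact ⟨d, ih β hβ hd⟩
    · obtain ⟨d, hd⟩ := (H.2 β hβ).1 d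
      exact ⟨d, ih β hβ hd⟩

/-- The initial segment of length `n` of a sequence of natural numbers. -/
def res (n : ℕ) (g : ℕ → ℕ) : Fin n → ℕ := fun i => g i

theorem res_congr {n : ℕ} {g h : ℕ → ℕ} (H : Agree n g h) : res n g = res n h :=
  funext fun i => H i i.2

theorem snoc_res (n : ℕ) (g : ℕ → ℕ) (c : ℕ) :
    (Fin.snoc (res n g) c : Fin (n + 1) → ℕ) = res (n + 1) (Function.update g n c) := by
  funext i
  refine Fin.lastCases ?_ (fun i => ?_) i
  · simp [res]
  · simp [res, i.2.ne]

theorem PartialElementary.relMap_iff {n : ℕ} {a b : Fin n → ℕ} (H : PartialElementary M N a b)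
    {k : ℕ} (R : L.Relations k) (x : Fin k → Fin n) :
    @FirstOrder.Language.Structure.RelMap L ℕ M k R (a ∘ x) ↔
      @FirstOrder.Language.Structure.RelMap L ℕ N k R (b ∘ x) := by
  have := H (R.formula fun i => FirstOrder.Language.Term.var (x i))
  rwa [@FirstOrder.Language.Formula.realize_rel L ℕ M,
    @FirstOrder.Language.Formula.realize_rel L ℕ N] at this

theorem PartialElementary.eq_iff {n : ℕ} {a b : Fin n → ℕ} (H : PartialElementary M N a b)
    (i j : Fin n) : a i = a j ↔ b i = b j := by
  have := H (FirstOrder.Language.Term.equal (FirstOrder.Language.Term.var i)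
    (FirstOrder.Language.Term.var j))
  rwa [@FirstOrder.Language.Formula.realize_equal L ℕ M,
    @FirstOrder.Language.Formula.realize_equal L ℕ N] at this

/-- In a game with `k` extra rounds, Player II can answer any `k` moves in the right-hand
structure. -/
theorem PlayerTwoWins.exists_extension {α : Ordinal.{0}} {n m : ℕ} (hnm : n ≤ m) {g g' : ℕ → ℕ}
    (H : PlayerTwoWins M N (α + ω) (res n g) (res n g')) {c' : Inj} (hc' : Agree n c'.1 g') :
    ∃ c : Inj, Agree n c.1 g ∧ PlayerTwoWins M N α (res m c.1) (res m c'.1) := by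
  obtain ⟨k, rfl⟩ := Nat.exists_eq_add_of_le hnm
  -- Each answered move costs one successor step of the clock. The `ω` spare steps cover every
  -- finite `k`.
  have key : ∀ k : ℕ, ∀ β : Ordinal.{0}, PlayerTwoWins M N (β + k) (res n g) (res n g') →
      ∃ c : ℕ → ℕ, Agree n c g ∧ PlayerTwoWins M N β (res (n + k) c) (res (n + k) c'.1) := by
    intro k
    induction k with
    | zero =>
      intro β h
      refine ⟨g, Agree.refl _ _, ?_⟩
      rw [res_congr (hc'.mono (le_refl (n + 0)))]
      simpa using h
    | succ k ih =>
      intro β h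
      obtain ⟨c, hc, hw⟩ := ih (β + 1) (by
        have : β + 1 + (k : Ordinal) = β + ((k + 1 : ℕ) : Ordinal) := by
          rw [add_assoc]; congr 1; norm_cast; omega
        rwa [this])
      rw [PlayerTwoWins] at hw
      obtain ⟨d, hd⟩ := (hw.2 β (by simp)).2 (c'.1 (n + k))
      rw [snoc_res, snoc_res, Function.update_eq_self] at hd
      refine ⟨_, fun i hi => ?_, hd⟩
      rw [Function.update_of_ne (by omega), hc i hi]
  obtain ⟨c, hc, hw⟩ := key k α (H.mono (by gcongr; exact (natCast_lt_omega0 k).le))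
  -- The answers form an injective finite sequence because partial elementary maps preserve
  -- inequality; only this initial segment matters.
  obtain ⟨d, hd⟩ := exists_inj_agree (n := n + k) (f := c) (by
    intro i hi j hj hij
    have := (hw.partialElementary.eq_iff ⟨i, hi⟩ ⟨j, hj⟩).1 hij
    exact c'.2 this)
  refine ⟨d, (hd.mono hnm).trans hc, ?_⟩
  rwa [res_congr hd]

end Game

section Iso

universe u v
variable {L : FirstOrder.Language.{u, v}}

theorem Iso.symm {M N : StructureSpace L} : Iso M N → Iso N M :=
  fun ⟨e⟩ => ⟨@FirstOrder.Language.Equiv.symm L ℕ ℕ M N e⟩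

theorem Iso.trans {M N K : StructureSpace L} : Iso M N → Iso N K → Iso M K :=
  fun ⟨e⟩ ⟨f⟩ => ⟨@FirstOrder.Language.Equiv.comp L ℕ ℕ M N ℕ K f e⟩

theorem theory_model_of_equiv {A B : Type*} [L.Structure A] [L.Structure B]
    (e : FirstOrder.Language.Equiv L A B) {T : L.Theory} (h : B ⊨ T) : A ⊨ T :=
  FirstOrder.Language.StrongHomClass.theory_model e.symm

theorem Iso.mem_modelSpace {T : L.Theory} {M N : StructureSpace L} (h : Iso M N)
    (hN : N ∈ ModelSpace T) : M ∈ ModelSpace T := by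
  obtain ⟨e⟩ := h
  exact @theory_model_of_equiv L ℕ ℕ M N e T hN

end Iso

/-! ### Vaught transforms of Borel sets. -/

section Vaught

universe v
variable {L : FirstOrder.Language.{0, v}} [L.IsRelational]

/-- The pullback of a structure on `ℕ` along a map `ℕ → ℕ`. -/
def pull (g : ℕ → ℕ) (N : StructureSpace L) : StructureSpace L where
  funMap := fun f _ => isEmptyElim f
  RelMap := fun R x => @FirstOrder.Language.Structure.RelMap L ℕ N _ R (g ∘ x)

/-- Generically many extensions `h` of `g ↾ n` satisfy `(M, h ∗ N) ∈ A`. -/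
def Generic (A : Set (StructureSpace L × StructureSpace L)) (M N : StructureSpace L) (n : ℕ)
    (g : Inj) : Prop :=
  ∀ᶠ h in residual Inj, Agree n h.1 g.1 → (M, pull h.1 N) ∈ A

/-- The Vaught transforms of `A` are invariant under some countable level of equivalence. -/
def VaughtInvariant (A : Set (StructureSpace L × StructureSpace L)) : Prop :=
  (∀ M N, BaireMeasurableSet {h : Inj | (M, pull h.1 N) ∈ A}) ∧
    ∃ α < ω_ 1, ∀ M N N' n g g', PlayerTwoWins N N' α (res n g.1) (res n g'.1) →
      (Generic A M N n g ↔ Generic A M N' n g')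

theorem exists_res_comp (n : ℕ) {k : ℕ} (x : Fin k → ℕ) :
    ∃ m, n ≤ m ∧ ∃ y : Fin k → Fin m, ∀ g : ℕ → ℕ, g ∘ x = res m g ∘ y := by
  refine ⟨max n (∑ i, x i + 1), le_max_left _ _, fun i => ⟨x i, ?_⟩, fun g => rfl⟩
  have := Finset.single_le_sum (f := x) (fun _ _ => Nat.zero_le _) (Finset.mem_univ i)
  exact lt_max_of_lt_right (by omega)

/-- The atomic fact reads only finitely many values of the injection. Any extension on one side is
matched, up to that length, by an extension on the other side, where genericity supplies a witness
to the fact. -/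
theorem vaughtInvariant_relMap_right {k : ℕ} (R : L.Relations k) (x : Fin k → ℕ) :
    VaughtInvariant {p : StructureSpace L × StructureSpace L |
      @FirstOrder.Language.Structure.RelMap L ℕ p.2 k R x} := by
  have ho : ∀ N : StructureSpace L,
      IsOpen {h : Inj | @FirstOrder.Language.Structure.RelMap L ℕ N k R (h.1 ∘ x)} := by
    intro N
    have : Continuous fun h : Inj => h.1 ∘ x := by
      exact continuous_pi fun i => (continuous_apply (x i)).comp continuous_subtype_val
    exact (isOpen_discrete
      {y : Fin k → ℕ | @FirstOrder.Language.Structure.RelMap L ℕ N k R y}).preimage this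
  refine ⟨fun M N => (ho N).baireMeasurableSet, ω, omega0_lt_omega_one, ?_⟩
  have key : ∀ (M N N' : StructureSpace L) n (g g' : Inj),
      PlayerTwoWins N N' ω (res n g.1) (res n g'.1) →
      Generic {p : StructureSpace L × StructureSpace L |
        @FirstOrder.Language.Structure.RelMap L ℕ p.2 k R x} M N n g →
      Generic {p : StructureSpace L × StructureSpace L |
        @FirstOrder.Language.Structure.RelMap L ℕ p.2 k R x} M N' n g' := by
    intro M N N' n g g' hw hg
    refine Eventually.of_forall fun c' hc' => ?_
    obtain ⟨m, hnm, y, hy⟩ := exists_res_comp n x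
    obtain ⟨c, hc, hcw⟩ := PlayerTwoWins.exists_extension (α := 0) hnm (by simpa using hw) hc'
    have hiff := hcw.partialElementary.relMap_iff R y
    rw [← hy, ← hy] at hiff
    refine hiff.1 ?_
    obtain ⟨h, hh, hR⟩ := exists_of_eventually_agree c m
      (p := fun h => @FirstOrder.Language.Structure.RelMap L ℕ N k R (h.1 ∘ x)) (by
        filter_upwards [hg] with h hh hc2 using hh ((hc2.mono hnm).trans hc))
    rwa [hy, res_congr hh, ← hy] at hR
  exact fun M N N' n g g' hw => ⟨key M N N' n g g' hw, key M N' N n g' g hw.symm⟩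

/-- The first structure is never moved, so the transform is constantly true or, by Baire category,
constantly false. -/
theorem vaughtInvariant_left (S : Set (StructureSpace L)) :
    VaughtInvariant {p : StructureSpace L × StructureSpace L | p.1 ∈ S} := by
  refine ⟨fun M N => ?_, 0, omega_pos 1, fun M N N' n g g' _ => ?_⟩
  · by_cases h : M ∈ S <;> simp only [Set.mem_ofPred_eq, h, Set.ofPred_true, Set.ofPred_false]
    · exact isOpen_univ.baireMeasurableSet
    · exact isOpen_empty.baireMeasurableSet
  · by_cases h : M ∈ S
    · simp [Generic, h]
    · refine iff_of_false (fun H => ?_) fun H => ?_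
      · exact h (exists_of_eventually_agree g n H).choose_spec.2
      · exact h (exists_of_eventually_agree g' n H).choose_spec.2

/-- By `forall_generic_not_iff`, failure is witnessed by a longer finite injection at which `A`
holds generically. Transferring a witness of unknown finite length costs `ω` additional rounds. -/
theorem VaughtInvariant.compl {A : Set (StructureSpace L × StructureSpace L)}
    (hA : VaughtInvariant A) : VaughtInvariant Aᶜ := by
  obtain ⟨hB, α, hα, H⟩ := hA
  have key : ∀ (M N N' : StructureSpace L) n (g g' : Inj),
      PlayerTwoWins N N' (α + ω) (res n g.1) (res n g'.1) →
      Generic Aᶜ M N n g → Generic Aᶜ M N' n g' := by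
    intro M N N' n g g' hw hg
    refine (forall_generic_not_iff (hB M N') g' n).2 fun m c' hnm hc' hG => ?_
    obtain ⟨c, hc, hcw⟩ := hw.exists_extension hnm hc'
    exact (forall_generic_not_iff (hB M N) g n).1 hg m c hnm hc ((H M N N' m c c' hcw).2 hG)
  refine ⟨fun M N => (hB M N).compl, α + ω, ?_, fun M N N' n g g' hw =>
    ⟨key M N N' n g g' hw, key M N' N n g' g hw.symm⟩⟩
  exact (isPrincipal_add_omega 1) hα omega0_lt_omega_one

/-- Comeagre sets are closed under countable intersections, and a countable supremum of countable
ordinals is countable. -/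
theorem VaughtInvariant.iInter {A : ℕ → Set (StructureSpace L × StructureSpace L)}
    (hA : ∀ i, VaughtInvariant (A i)) : VaughtInvariant (⋂ i, A i) := by
  choose hB α hα H using hA
  refine ⟨fun M N => ?_, ⨆ i, α i, Ordinal.iSup_lt_omega_one hα, fun M N N' n g g' hw => ?_⟩
  · have : {h : Inj | (M, pull h.1 N) ∈ ⋂ i, A i} = ⋂ i, {h : Inj | (M, pull h.1 N) ∈ A i} := by
      ext; simp
    rw [this]
    exact BaireMeasurableSet.iInter fun i => hB i M N
  · have aux : ∀ N n g, Generic (⋂ i, A i) M N n g ↔ ∀ i, Generic (A i) M N n g := by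
      intro N n g
      simp only [Generic, Set.mem_iInter]
      rw [← eventually_countable_forall]
      exact eventually_congr (Eventually.of_forall fun h =>
        ⟨fun h1 i h2 => h1 h2 i, fun h1 h2 i => h1 i h2⟩)
    rw [aux, aux]
    exact forall_congr' fun i => H i M N N' n g g' (hw.mono (Ordinal.le_iSup _ i))

theorem VaughtInvariant.iUnion {A : ℕ → Set (StructureSpace L × StructureSpace L)}
    (hA : ∀ i, VaughtInvariant (A i)) : VaughtInvariant (⋃ i, A i) := by
  have := (VaughtInvariant.iInter fun i => (hA i).compl).compl
  simpa [Set.compl_iInter] using this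

/-- A subbasis of the logic topology for a relational language. -/
def subbasis (L : FirstOrder.Language.{0, v}) : Set (Set (StructureSpace L)) :=
  Set.range (fun q : (Σ n : ℕ, L.Relations n × (Fin n → ℕ)) =>
      {M : StructureSpace L | @FirstOrder.Language.Structure.RelMap L ℕ M _ q.2.1 q.2.2}) ∪
    Set.range (fun q : (Σ n : ℕ, L.Relations n × (Fin n → ℕ)) =>
      {M : StructureSpace L | ¬ @FirstOrder.Language.Structure.RelMap L ℕ M _ q.2.1 q.2.2})

theorem logicTopology_eq : (inferInstance : TopologicalSpace (StructureSpace L)) =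
    TopologicalSpace.generateFrom (subbasis L) := by
  refine congrArg TopologicalSpace.generateFrom ?_
  ext U
  simp only [subbasis, Set.mem_union, Set.mem_ofPred_eq, Set.mem_range, Sigma.exists, Prod.exists,
    eq_comm (a := U)]
  constructor
  · rintro ((h | h) | ⟨n, f, -⟩)
    · exact Or.inl h
    · exact Or.inr h
    · exact isEmptyElim f
  · exact fun h => Or.inl h

variable [∀ n, Countable (L.Relations n)]

/-- Countability of the language makes the space second countable, so the Borel sets are generated
by the subbasis as a σ-algebra and induction on their generation applies. -/
theorem vaughtInvariant_of_borel {A : Set (StructureSpace L × StructureSpace L)}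
    (hA : @MeasurableSet _ (borel (StructureSpace L × StructureSpace L)) A) :
    VaughtInvariant A := by
  have hc : (subbasis L).Countable := (Set.countable_range _).union (Set.countable_range _)
  have : SecondCountableTopology (StructureSpace L) := ⟨_, hc, logicTopology_eq⟩
  have htop : (inferInstance : TopologicalSpace (StructureSpace L × StructureSpace L)) =
      TopologicalSpace.generateFrom
        ((Set.preimage Prod.fst '' subbasis L) ∪ (Set.preimage Prod.snd '' subbasis L)) := by
    rw [generateFrom_union, ← induced_generateFrom_eq, ← induced_generateFrom_eq,
      ← logicTopology_eq]
    rfl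
  rw [borel_eq_generateFrom_of_subbasis htop] at hA
  refine MeasurableSpace.generateFrom_induction _ (fun s _ => VaughtInvariant s) ?_ ?_ ?_ ?_ A hA
  · rintro t (⟨s, hs, rfl⟩ | ⟨s, (⟨q, rfl⟩ | ⟨q, rfl⟩), rfl⟩) -
    · exact vaughtInvariant_left s
    · exact vaughtInvariant_relMap_right q.2.1 q.2.2
    · exact (vaughtInvariant_relMap_right q.2.1 q.2.2).compl
  · exact vaughtInvariant_left ∅
  · exact fun t _ ht => ht.compl
  · exact fun s _ hs => VaughtInvariant.iUnion hs

/-- If `g` is a bijection then `g ∗ N` is isomorphic to `N`. -/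
def pullEquiv (g : ℕ ≃ ℕ) (N : StructureSpace L) :
    @FirstOrder.Language.Equiv L ℕ ℕ (pull g N) N :=
  @FirstOrder.Language.Equiv.mk L ℕ ℕ (pull g N) N g (fun f _ => isEmptyElim f)
    fun _ _ => Iff.rfl

/-- If isomorphism on `Mod(T)` is Borel, then it is implied by some countable level of
equivalence. -/
theorem IsomorphismIsBorel.exists_level {T : L.Theory} (hT : IsomorphismIsBorel T) :
    ∃ α < ω_ 1, ∀ M ∈ ModelSpace T, ∀ N ∈ ModelSpace T, EquivUpTo α M N → Iso M N := by
  let ι : ModelSpace T × ModelSpace T → StructureSpace L × StructureSpace L :=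
    Prod.map Subtype.val Subtype.val
  have hι : (instTopologicalSpaceProd : TopologicalSpace (ModelSpace T × ModelSpace T)) =
      TopologicalSpace.induced ι instTopologicalSpaceProd :=
    (Topology.IsInducing.subtypeVal.prodMap Topology.IsInducing.subtypeVal).eq_induced
  unfold IsomorphismIsBorel at hT
  rw [hι, borel_comap] at hT
  -- `A` is Borel in the space of all pairs of structures and is controlled only on pairs of models
  -- of `T`.
  obtain ⟨A, hA, hAι⟩ := hT
  have hmem : ∀ M ∈ ModelSpace T, ∀ N ∈ ModelSpace T, (M, N) ∈ A ↔ Iso M N := by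
    intro M hM N hN
    exact Set.ext_iff.1 hAι (⟨M, hM⟩, ⟨N, hN⟩)
  obtain ⟨-, α, hα, H⟩ := vaughtInvariant_of_borel hA
  refine ⟨α, hα, fun M hM N hN hMN => ?_⟩
  have hpull : ∀ (K : StructureSpace L) (h : Inj), Function.Surjective h.1 → Iso (pull h.1 K) K :=
    fun K h hs => ⟨pullEquiv (Equiv.ofBijective h.1 ⟨h.2, hs⟩) K⟩
  let g : Inj := ⟨id, Function.injective_id⟩
  have hg : res 0 g.1 = (Fin.elim0 : Fin 0 → ℕ) := Subsingleton.elim _ _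
  -- For surjective `h` the pullback is isomorphic to `M`. The invariance of the transform then
  -- replaces the second `M` by `N`.
  have h1 : Generic A M M 0 g := by
    filter_upwards [eventually_surjective_residual] with h hs _
    have hi := hpull M h hs
    exact (hmem M hM _ (hi.mem_modelSpace hM)).2 hi.symm
  have h2 : Generic A M N 0 g := (H M M N 0 g g (by rw [hg]; exact hMN)).1 h1
  obtain ⟨h, -, hs, hA'⟩ := exists_of_eventually_agree g 0
    (p := fun h => Function.Surjective h.1 ∧ (M, pull h.1 N) ∈ A) (by
      filter_upwards [h2, eventually_surjective_residual] with h h3 h4 h5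
      exact ⟨h4, h3 h5⟩)
  have hi := hpull N h hs
  exact ((hmem M hM _ (hi.mem_modelSpace hN)).1 hA').trans hi

end Vaught

end CountableModels

/-! ### Coloured trees and their back-and-forth equivalence. -/

namespace RefBin

open CountableModels Ordinal

/-- The branches of the full binary tree. A *coloured tree* is a map `m : Branch → ℕ`, the branch
`x` being present with multiplicity `m x`. -/
abbrev Branch : Type := ℕ → Bool

/-- Prepend a bit to a branch. -/
def cons (i : Bool) (w : Branch) : Branch
  | 0 => i
  | k + 1 => w k

/-- Remove the first bit of a branch. -/
def tl (x : Branch) : Branch := fun k => x (k + 1)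

@[simp] theorem cons_zero (i : Bool) (w : Branch) : cons i w 0 = i := rfl
@[simp] theorem cons_succ (i : Bool) (w : Branch) (k : ℕ) : cons i w (k + 1) = w k := rfl
@[simp] theorem tl_cons (i : Bool) (w : Branch) : tl (cons i w) = w := rfl
@[simp] theorem tl_apply (x : Branch) (k : ℕ) : tl x k = x (k + 1) := rfl

@[simp] theorem cons_tl (x : Branch) : cons (x 0) (tl x) = x := by
  funext k
  cases k <;> rfl

theorem agree_succ {n : ℕ} {x y : Branch} :
    Agree (n + 1) x y ↔ x 0 = y 0 ∧ Agree n (tl x) (tl y) :=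
  ⟨fun h => ⟨h 0 n.succ_pos, fun k hk => h (k + 1) (by omega)⟩, fun h k hk => by
    cases k with
    | zero => exact h.1
    | succ k => exact h.2 k (by omega)⟩

theorem agree_succ_last {A : Type*} {n : ℕ} {x y : ℕ → A} :
    Agree (n + 1) x y ↔ Agree n x y ∧ x n = y n :=
  ⟨fun h => ⟨h.mono n.le_succ, h n n.lt_succ_self⟩, fun h k hk => by
    rcases (Nat.lt_succ_iff.1 hk).lt_or_eq with hk | rfl
    · exact h.1 k hk
    · exact h.2⟩

/-- The coloured tree whose two halves are `f false` and `f true`. -/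
def join (f : Bool → Branch → ℕ) (x : Branch) : ℕ := f (x 0) (tl x)

/-- The branch which follows `x` up to level `n`, turns away from `x` there, and continues with
`w`. -/
def turn (x : Branch) (n : ℕ) (w : Branch) : Branch := fun k =>
  if k < n then x k else if k = n then !x n else w (k - n - 1)

/-- The part of the coloured tree `m` which leaves the branch `x` at level `n`. -/
def sib (m : Branch → ℕ) (x : Branch) (n : ℕ) : Branch → ℕ := fun w => m (turn x n w)

theorem sib_join_zero (f : Bool → Branch → ℕ) (x : Branch) : sib (join f) x 0 = f (!x 0) := by
  funext w
  simp only [sib, join, turn]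
  congr 1

theorem sib_join_succ (f : Bool → Branch → ℕ) (x : Branch) (n : ℕ) :
    sib (join f) x (n + 1) = sib (f (x 0)) (tl x) n := by
  funext w
  have h0 : turn x (n + 1) w 0 = x 0 := by simp [turn]
  have h1 : tl (turn x (n + 1) w) = turn (tl x) n w := by
    funext k
    simp only [turn, tl_apply, Nat.add_lt_add_iff_right, Nat.add_right_cancel_iff]
    split_ifs <;> first | rfl | (congr 1; omega)
  simp only [sib, join, h0, h1]

/-- A back-and-forth equivalence of coloured trees: Player II answers a branch by a branch of the
same multiplicity in such a way that the parts which leave the two branches at any given level are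
equivalent to all smaller degrees. -/
def Sim (α : Ordinal.{0}) (m m' : Branch → ℕ) : Prop :=
  ∀ β : Ordinal.{0}, β < α →
    (∀ x, m x ≠ 0 → ∃ y, m' y = m x ∧ ∀ n, Sim β (sib m x n) (sib m' y n)) ∧
    (∀ y, m' y ≠ 0 → ∃ x, m x = m' y ∧ ∀ n, Sim β (sib m x n) (sib m' y n))
termination_by α

theorem Sim.mono {α β : Ordinal.{0}} (h : β ≤ α) {m m' : Branch → ℕ} (H : Sim α m m') :
    Sim β m m' := by
  rw [Sim] at H ⊢
  exact fun γ hγ => H γ (hγ.trans_le h)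

theorem Sim.refl (α : Ordinal.{0}) (m : Branch → ℕ) : Sim α m m := by
  induction α using WellFoundedLT.induction generalizing m with
  | _ α ih =>
    rw [Sim]
    exact fun β hβ => ⟨fun x _ => ⟨x, rfl, fun n => ih β hβ _⟩,
      fun x _ => ⟨x, rfl, fun n => ih β hβ _⟩⟩

theorem Sim.symm {α : Ordinal.{0}} {m m' : Branch → ℕ} (H : Sim α m m') : Sim α m' m := by
  induction α using WellFoundedLT.induction generalizing m m' with
  | _ α ih =>
    rw [Sim] at H ⊢
    refine fun β hβ => ⟨fun x hx => ?_, fun x hx => ?_⟩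
    · obtain ⟨y, hy, h⟩ := (H β hβ).2 x hx
      exact ⟨y, hy, fun n => ih β hβ (h n)⟩
    · obtain ⟨y, hy, h⟩ := (H β hβ).1 x hx
      exact ⟨y, hy, fun n => ih β hβ (h n)⟩

/-- Keep the first bit and answer inside that half. The sibling at level 0 is the other half,
equivalent by hypothesis; the later siblings come from the answer. -/
theorem Sim.join_forth {α β : Ordinal.{0}} (hβ : β < α) {f f' : Bool → Branch → ℕ}
    (H : ∀ i, Sim α (f i) (f' i)) (x : Branch) (hx : join f x ≠ 0) :
    ∃ y, join f' y = join f x ∧ ∀ n, Sim β (sib (join f) x n) (sib (join f') y n) := by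
  have h := H (x 0)
  rw [Sim] at h
  obtain ⟨y, hy, hs⟩ := (h β hβ).1 (tl x) hx
  refine ⟨cons (x 0) y, by simpa [join] using hy, fun n => ?_⟩
  cases n with
  | zero => simpa [sib_join_zero] using (H _).mono hβ.le
  | succ n => simpa [sib_join_succ] using hs n

theorem Sim.join {α : Ordinal.{0}} {f f' : Bool → Branch → ℕ} (H : ∀ i, Sim α (f i) (f' i)) :
    Sim α (join f) (join f') := by
  rw [Sim]
  refine fun β hβ => ⟨Sim.join_forth hβ H, fun y hy => ?_⟩
  obtain ⟨x, hx, h⟩ := Sim.join_forth hβ (fun i => (H i).symm) y hy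
  exact ⟨x, hx, fun n => (h n).symm⟩

/-! ### Ramified trees: equivalence for different dense sets. -/

open Classical in
/-- The full binary tree with the coloured tree `W n i` hung beside the `n`-th edge of a branch if
this edge is labelled `i`; a branch of the full binary tree itself is present, with
multiplicity 2, if it belongs to `Z`. -/
noncomputable def ramify (Z : Set Branch) (W : ℕ → Bool → Branch → ℕ) (x : Branch) : ℕ :=
  if h : ∃ n, x (2 * n + 1) = true then
    W (Nat.find h) (x (2 * Nat.find h)) (fun k => x (2 * Nat.find h + 2 + k))
  else if (fun k => x (2 * k)) ∈ Z then 2 else 0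

/-- The branch in `ramify Z W` which corresponds to the branch `z` of the full binary tree. -/
def spine (z : Branch) : Branch := fun k => if k % 2 = 0 then z (k / 2) else false

theorem spine_zero (z : Branch) : spine z 0 = z 0 := rfl

theorem spine_one (z : Branch) : spine z 1 = false := rfl

theorem tl_tl_spine (z : Branch) : tl (tl (spine z)) = spine (tl z) := by
  funext k
  have h1 : (k + 1 + 1) % 2 = k % 2 := by omega
  have h2 : (k + 1 + 1) / 2 = k / 2 + 1 := by omega
  simp [spine, tl_apply, h1, h2]

theorem ramify_spine (Z : Set Branch) (W : ℕ → Bool → Branch → ℕ) (z : Branch) [Decidable (z ∈ Z)] :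
    ramify Z W (spine z) = if z ∈ Z then 2 else 0 := by
  have h1 : ¬ ∃ n, spine z (2 * n + 1) = true := by
    rintro ⟨n, hn⟩
    have : (2 * n + 1) % 2 = 1 := by omega
    simp [spine, this] at hn
  have h2 : (fun k => spine z (2 * k)) = z := by
    funext k
    simp [spine]
  rw [ramify, dif_neg h1, h2]
  congr

theorem exists_spine_or (x : Branch) : (∃ z, x = spine z) ∨ ∃ n, x (2 * n + 1) = true := by
  by_cases h : ∃ n, x (2 * n + 1) = true
  · exact Or.inr h
  · push Not at h
    refine Or.inl ⟨fun k => x (2 * k), funext fun k => ?_⟩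
    rcases Nat.even_or_odd' k with ⟨c, rfl | rfl⟩
    · simp [spine]
    · have : (2 * c + 1) % 2 = 1 := by omega
      simpa [spine, this] using h c

/-- The branches in `Z` through the vertex `i`. -/
def above (Z : Set Branch) (i : Bool) : Set Branch := {z | cons i z ∈ Z}

/-- Two bits are consumed at a time: the first chooses an edge, the second tells whether to leave
into the tree hung there. This recursion lets the facts on `join` apply. -/
theorem ramify_eq (Z : Set Branch) (W : ℕ → Bool → Branch → ℕ) :
    ramify Z W = join fun i => join fun j =>
      if j then W 0 i else ramify (above Z i) fun n => W (n + 1) := by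
  classical
  funext x
  rcases hx : x 1 with _ | _
  · have hj : (join fun i => join fun j =>
      if j then W 0 i else ramify (above Z i) fun n => W (n + 1)) x =
        ramify (above Z (x 0)) (fun n => W (n + 1)) (tl (tl x)) := by
      simp [join, hx]
    rw [hj]
    rcases exists_spine_or x with ⟨z, rfl⟩ | h
    · rw [tl_tl_spine, ramify_spine, ramify_spine, spine_zero]
      simp [above]
    · have h' : ∃ n, tl (tl x) (2 * n + 1) = true := by
        obtain ⟨n, hn⟩ := h
        cases n with
        | zero => simp [hx] at hn
        | succ n => exact ⟨n, hn⟩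
      have hf : Nat.find h = Nat.find h' + 1 := by
        rw [Nat.find_eq_iff]
        refine ⟨Nat.find_spec h', fun n hn => ?_⟩
        cases n with
        | zero => simp [hx]
        | succ n => exact Nat.find_min h' (by omega)
      rw [ramify, ramify, dif_pos h, dif_pos h', hf]
      simp only [tl_apply]
      congr 1
      funext k
      congr 1
      omega
  · have h : ∃ n, x (2 * n + 1) = true := ⟨0, hx⟩
    have hf : Nat.find h = 0 := by simpa [Nat.find_eq_zero] using hx
    rw [ramify, dif_pos h, hf]
    simp only [join, tl_apply, zero_add, hx, if_true, mul_zero]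
    congr 1
    funext k
    simp only [tl_apply]
    congr 1
    omega

theorem ramify_eq_of_exists {x : Branch} (h : ∃ n, x (2 * n + 1) = true) (Z Z' : Set Branch)
    (W : ℕ → Bool → Branch → ℕ) : ramify Z W x = ramify Z' W x := by
  rw [ramify, ramify, dif_pos h, dif_pos h]

theorem sib_ramify_zero (Z : Set Branch) (W : ℕ → Bool → Branch → ℕ) (x : Branch) :
    sib (ramify Z W) x 0 = join fun j =>
      if j then W 0 (!x 0) else ramify (above Z (!x 0)) fun n => W (n + 1) := by
  rw [ramify_eq, sib_join_zero]

theorem sib_ramify_one (Z : Set Branch) (W : ℕ → Bool → Branch → ℕ) (x : Branch) :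
    sib (ramify Z W) x 1 =
      if !x 1 then W 0 (x 0) else ramify (above Z (x 0)) fun n => W (n + 1) := by
  rw [ramify_eq, sib_join_succ, sib_join_zero]
  simp

theorem sib_ramify_add_two (Z : Set Branch) (W : ℕ → Bool → Branch → ℕ) (x : Branch) (k : ℕ) :
    sib (ramify Z W) x (k + 2) =
      sib (if x 1 then W 0 (x 0) else ramify (above Z (x 0)) fun n => W (n + 1)) (tl (tl x)) k := by
  rw [ramify_eq, sib_join_succ, sib_join_succ]
  simp

/-- Density of a set of branches in the space of all branches. -/
def DenseSet (Z : Set Branch) : Prop := ∀ x n, ∃ z ∈ Z, Agree n z x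

theorem DenseSet.above {Z : Set Branch} (h : DenseSet Z) (i : Bool) : DenseSet (above Z i) := by
  intro x n
  obtain ⟨z, hz, hag⟩ := h (cons i x) (n + 1)
  rw [agree_succ] at hag
  refine ⟨tl z, ?_, hag.2⟩
  have : cons i (tl z) = z := by rw [← cons_tl z, hag.1]; simp
  rwa [RefBin.above, Set.mem_ofPred_eq, this]

/-- A sibling along a common branch either lies in a common hung tree, or is or contains the
remainder of the ramified tree, and the remainders are equivalent by `H`. The shift `j` records the
depth reached. -/
theorem sim_sib_ramify {γ : Ordinal.{0}} {W : ℕ → Bool → Branch → ℕ}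
    (H : ∀ j Z Z', DenseSet Z → DenseSet Z' →
      Sim γ (ramify Z fun n => W (n + j)) (ramify Z' fun n => W (n + j))) (k : ℕ) :
    ∀ j x Z Z', DenseSet Z → DenseSet Z' →
      Sim γ (sib (ramify Z fun n => W (n + j)) x k) (sib (ramify Z' fun n => W (n + j)) x k) := by
  have e : ∀ n j : ℕ, n + 1 + j = n + (j + 1) := fun n j => by omega
  induction k using Nat.twoStepInduction with
  | zero =>
    intro j x Z Z' hZ hZ'
    rw [sib_ramify_zero, sib_ramify_zero]
    refine Sim.join fun i => ?_
    cases i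
    · simpa [e] using H (j + 1) _ _ (hZ.above _) (hZ'.above _)
    · exact Sim.refl _ _
  | one =>
    intro j x Z Z' hZ hZ'
    rw [sib_ramify_one, sib_ramify_one]
    cases x 1
    · exact Sim.refl _ _
    · simpa [e] using H (j + 1) _ _ (hZ.above _) (hZ'.above _)
  | more k ih _ =>
    intro j x Z Z' hZ hZ'
    rw [sib_ramify_add_two, sib_ramify_add_two]
    cases x 1
    · simpa [e] using ih (j + 1) (tl (tl x)) _ _ (hZ.above _) (hZ'.above _)
    · exact Sim.refl _ _

/-- The hung trees met along two spines are the same where the spines take equal bits; elsewhere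
both choices of hung tree must be equivalent. -/
theorem sim_sib_spine {γ : Ordinal.{0}} {W : ℕ → Bool → Branch → ℕ}
    (H : ∀ j Z Z', DenseSet Z → DenseSet Z' →
      Sim γ (ramify Z fun n => W (n + j)) (ramify Z' fun n => W (n + j))) (k : ℕ) :
    ∀ j z z' Z Z', DenseSet Z → DenseSet Z' →
      (∀ n, z n = z' n ∨ ∀ i i', Sim γ (W (n + j) i) (W (n + j) i')) →
      Sim γ (sib (ramify Z fun n => W (n + j)) (spine z) k)
        (sib (ramify Z' fun n => W (n + j)) (spine z') k) := by
  have e : ∀ n j : ℕ, n + 1 + j = n + (j + 1) := fun n j => by omega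
  induction k using Nat.twoStepInduction with
  | zero =>
    intro j z z' Z Z' hZ hZ' hz
    rw [sib_ramify_zero, sib_ramify_zero]
    refine Sim.join fun i => ?_
    cases i
    · simpa [e] using H (j + 1) _ _ (hZ.above _) (hZ'.above _)
    · simp only [if_true, spine_zero]
      rcases hz 0 with h | h
      · rw [h]; exact Sim.refl _ _
      · exact h _ _
  | one =>
    intro j z z' Z Z' hZ hZ' hz
    rw [sib_ramify_one, sib_ramify_one]
    simp only [spine_one, spine_zero, Bool.not_false, if_true]
    rcases hz 0 with h | h
    · rw [h]; exact Sim.refl _ _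
    · exact h _ _
  | more k ih _ =>
    intro j z z' Z Z' hZ hZ' hz
    rw [sib_ramify_add_two, sib_ramify_add_two]
    simp only [spine_one, tl_tl_spine, e, Bool.false_eq_true, if_false]
    refine ih (j + 1) (tl z) (tl z') _ _ (hZ.above _) (hZ'.above _) fun n => ?_
    rw [← e]
    exact hz (n + 1)

theorem sim_ramify {α : Ordinal.{0}} {W : ℕ → Bool → Branch → ℕ}
    (hW : ∀ γ < α, ∃ N, ∀ n ≥ N, ∀ i i', Sim γ (W n i) (W n i')) :
    ∀ j Z Z', DenseSet Z → DenseSet Z' →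
      Sim α (ramify Z fun n => W (n + j)) (ramify Z' fun n => W (n + j)) := by
  induction α using WellFoundedLT.induction with
  | _ α ih =>
    have forth : ∀ γ < α, ∀ j Z Z', DenseSet Z → DenseSet Z' →
        ∀ x, ramify Z (fun n => W (n + j)) x ≠ 0 →
          ∃ y, ramify Z' (fun n => W (n + j)) y = ramify Z (fun n => W (n + j)) x ∧
          ∀ k, Sim γ (sib (ramify Z fun n => W (n + j)) x k)
            (sib (ramify Z' fun n => W (n + j)) y k) := by
      classical
      intro γ hγ j Z Z' hZ hZ' x hx
      have H := ih γ hγ fun δ hδ => hW δ (hδ.trans hγ)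
      rcases exists_spine_or x with ⟨z, rfl⟩ | h
      · obtain ⟨N, hN⟩ := hW γ hγ
        -- Beyond `N` the two hung trees at an edge are `γ`-equivalent, so agreement up to `N` is
        -- enough.
        obtain ⟨z', hz', hag⟩ := hZ' z N
        have hz : z ∈ Z := by
          by_contra hz
          rw [ramify_spine, if_neg hz] at hx
          exact hx rfl
        refine ⟨spine z', ?_, fun k => sim_sib_spine H k j z z' Z Z' hZ hZ' fun n => ?_⟩
        · rw [ramify_spine, ramify_spine, if_pos hz, if_pos hz']
        · rcases lt_or_ge n N with hn | hn
          · exact Or.inl (hag n hn).symm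
          · exact Or.inr (hN (n + j) (by omega))
      -- A branch which enters a hung tree is common to both trees and is answered by itself.
      · exact ⟨x, ramify_eq_of_exists h _ _ _, fun k => sim_sib_ramify H k j x Z Z' hZ hZ'⟩
    intro j Z Z' hZ hZ'
    rw [Sim]
    refine fun γ hγ => ⟨forth γ hγ j Z Z' hZ hZ', fun y hy => ?_⟩
    obtain ⟨x, hx, hs⟩ := forth γ hγ j Z' Z hZ' hZ y hy
    exact ⟨x, hx, fun k => (hs k).symm⟩

/-! ### Rigidity of ramified trees. -/

/-- An isometric map of branches which preserves multiplicities. -/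
structure IsEmb (φ : Branch → Branch) (m m' : Branch → ℕ) : Prop where
  agree_iff : ∀ n x y, Agree n x y ↔ Agree n (φ x) (φ y)
  map_eq : ∀ x, m' (φ x) = m x

/-- An isometry keeps or swaps the two halves; the bit `b` records which. -/
theorem IsEmb.join {φ : Branch → Branch} {f f' : Bool → Branch → ℕ}
    (h : IsEmb φ (join f) (join f')) :
    ∃ b, (∀ x, φ x 0 = xor b (x 0)) ∧
      ∀ i, IsEmb (fun w => tl (φ (cons i w))) (f i) (f' (xor b i)) := by
  have h1 : ∀ x y, x 0 = y 0 ↔ φ x 0 = φ y 0 := fun x y => by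
    simpa [agree_succ, Agree] using h.agree_iff 1 x y
  let w : Branch := fun _ => false
  have hb : ∀ x, φ x 0 = xor (φ w 0) (x 0) := by
    intro x
    have := h1 x w
    have hw : w 0 = false := rfl
    rw [hw] at this
    revert this
    cases x 0 <;> cases φ x 0 <;> cases φ w 0 <;> simp
  refine ⟨φ w 0, hb, fun i => ⟨fun n x y => ?_, fun x => ?_⟩⟩
  · have := h.agree_iff (n + 1) (cons i x) (cons i y)
    rw [agree_succ, agree_succ, hb (cons i x), hb (cons i y)] at this
    simpa using this
  · have := h.map_eq (cons i x)
    rw [RefBin.join, RefBin.join, hb] at this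
    simpa using this

/-- The coloured tree which is hung on a ramified tree in place of `P`; the left half marks it as
being hung. -/
def hang (A P : Branch → ℕ) : Branch → ℕ := join fun j => if j then P else A

theorem exists_ramify_eq_two {Z : Set Branch} (hZ : DenseSet Z) (W : ℕ → Bool → Branch → ℕ) :
    ∃ x, ramify Z W x = 2 := by
  classical
  obtain ⟨z, hz, -⟩ := hZ (fun _ => false) 0
  exact ⟨spine z, by rw [ramify_spine, if_pos hz]⟩

/-- Both halves of a ramified tree have a branch of multiplicity 2, and one of them would be sent
into `A`. -/
theorem not_isEmb_ramify_hang {φ : Branch → Branch} {Z : Set Branch} (hZ : DenseSet Z)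
    {W : ℕ → Bool → Branch → ℕ} {A P : Branch → ℕ} (hA : ∀ x, A x ≠ 2) :
    ¬ IsEmb φ (ramify Z W) (hang A P) := by
  intro h
  rw [ramify_eq] at h
  obtain ⟨b, -, h⟩ := h.join
  have h1 := h b
  simp only [Bool.xor_self, Bool.false_eq_true, if_false] at h1
  obtain ⟨x, hx⟩ := exists_ramify_eq_two (hZ.above b) fun n => W (n + 1)
  refine hA _ ((h1.map_eq (cons false x)).trans ?_)
  simpa [join] using hx

theorem not_isEmb_hang_hang {φ : Branch → Branch} {A P Q : Branch → ℕ} (hA : ∀ x, A x ≠ 2)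
    (hP : ∃ x, P x = 2) (hPQ : ∀ ψ, ¬ IsEmb ψ P Q) : ¬ IsEmb φ (hang A P) (hang A Q) := by
  intro h
  obtain ⟨b, -, h⟩ := h.join
  have h1 := h true
  cases b
  · exact hPQ _ (by simpa using h1)
  · obtain ⟨x, hx⟩ := hP
    exact hA _ ((by simpa using h1.map_eq x : A _ = P x).trans hx)

/-- At every odd bit a swap would send the remaining ramified tree into a hung one. At every even
bit a swap would embed `W j false` in `W j true`, or put a multiplicity 2 into `A`. -/
theorem IsEmb.spine_agree {A : Branch → ℕ} {W : ℕ → Bool → Branch → ℕ} (hA : ∀ x, A x ≠ 2)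
    (hW : ∀ n, ∃ x, W n false x = 2) (hne : ∀ n ψ, ¬ IsEmb ψ (W n false) (W n true)) (n : ℕ) :
    ∀ j φ Z Z' z, DenseSet Z → DenseSet Z' →
      IsEmb φ (ramify Z fun n i => hang A (W (n + j) i))
        (ramify Z' fun n i => hang A (W (n + j) i)) → Agree (2 * n) (φ (spine z)) (spine z) := by
  induction n with
  | zero => exact fun _ _ _ _ _ _ _ _ k hk => absurd hk (by omega)
  | succ n ih =>
    intro j φ Z Z' z hZ hZ' h
    rw [ramify_eq, ramify_eq] at h
    obtain ⟨b, hb, h⟩ := h.join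
    have key : ∀ i, (∀ w, φ (cons i w) 1 = w 0) ∧
        IsEmb (fun w => tl (tl (φ (cons i (cons true w))))) (hang A (W j i))
          (hang A (W j (xor b i))) ∧
        IsEmb (fun w => tl (tl (φ (cons i (cons false w)))))
          (ramify (above Z i) fun n i => hang A (W (n + (j + 1)) i))
          (ramify (above Z' (xor b i)) fun n i => hang A (W (n + (j + 1)) i)) := by
      intro i
      have e : ∀ n j : ℕ, n + 1 + j = n + (j + 1) := fun n j => by omega
      obtain ⟨c, hc, h⟩ := (h i).join
      cases c
      · refine ⟨fun w => by simpa using hc w, by simpa using h true, by simpa [e] using h false⟩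
      · exact absurd (by simpa using h false) (not_isEmb_ramify_hang (hZ.above i) hA)
    have hb' : b = false := by
      cases b
      · rfl
      · exact absurd (key false).2.1 (not_isEmb_hang_hang hA (hW j) (hne j))
    subst hb'
    obtain ⟨h1, -, h2⟩ := key (z 0)
    have hs : spine z = cons (z 0) (cons false (spine (tl z))) := by
      funext k
      match k with
      | 0 => rfl
      | 1 => rfl
      | k + 2 => exact congrFun (tl_tl_spine z) k
    have h3 := ih (j + 1) _ _ _ (tl z) (hZ.above _) (hZ'.above _) h2
    rw [show 2 * (n + 1) = 2 * n + 1 + 1 by ring, agree_succ, agree_succ]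
    refine ⟨by rw [hb]; simp, ?_, ?_⟩
    · rw [tl_apply, tl_apply, hs, h1]
      rfl
    · rw [tl_tl_spine, hs]
      exact h3

theorem not_isEmb_ramify {A : Branch → ℕ} {W : ℕ → Bool → Branch → ℕ} (hA : ∀ x, A x ≠ 2)
    (hW : ∀ n, ∃ x, W n false x = 2) (hne : ∀ n ψ, ¬ IsEmb ψ (W n false) (W n true))
    {Z Z' : Set Branch} (hZ : DenseSet Z) (hZ' : DenseSet Z') {z : Branch} (hz : z ∈ Z)
    (hz' : z ∉ Z') (φ : Branch → Branch) :
    ¬ IsEmb φ (ramify Z fun n i => hang A (W n i)) (ramify Z' fun n i => hang A (W n i)) := by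
  classical
  intro h
  have h1 : φ (spine z) = spine z := funext fun k =>
    IsEmb.spine_agree hA hW hne (k + 1) 0 φ Z Z' z hZ hZ' h k (by omega)
  have h2 := h.map_eq (spine z)
  rw [h1, ramify_spine, ramify_spine, if_pos hz, if_neg hz'] at h2
  exact absurd h2 (by norm_num)

/-! ### Admissible trees and the induction on the level. -/

/-- A coloured tree is *admissible* if its branches are countable in number and dense. -/
structure Admissible (m : Branch → ℕ) : Prop where
  countable : {x | m x ≠ 0}.Countable
  dense : ∀ n x, ∃ y, m y ≠ 0 ∧ Agree n y x

theorem Admissible.join {f : Bool → Branch → ℕ} (h : ∀ i, Admissible (f i)) :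
    Admissible (join f) where
  countable := by
    refine (Set.countable_iUnion fun i => (h i).countable.image (cons i)).mono fun x hx => ?_
    exact Set.mem_iUnion.2 ⟨x 0, tl x, hx, cons_tl x⟩
  dense n x := by
    obtain ⟨y, hy, hag⟩ := (h (x 0)).dense n (tl x)
    exact ⟨cons (x 0) y, by simpa [RefBin.join] using hy,
      (agree_succ.2 ⟨rfl, hag⟩ : Agree (n + 1) (cons (x 0) y) x).mono n.le_succ⟩

theorem countable_drop {S : Set Branch} (hS : S.Countable) (n : ℕ) :
    {x : Branch | (fun k => x (n + k)) ∈ S}.Countable := by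
  induction n with
  | zero =>
    have : {x : Branch | (fun k => x (0 + k)) ∈ S} = S := by
      ext x
      simp only [zero_add]
      rfl
    rwa [this]
  | succ n ih =>
    refine (Set.countable_iUnion fun i => ih.image (cons i)).mono fun x hx => ?_
    refine Set.mem_iUnion.2 ⟨x 0, tl x, ?_, cons_tl x⟩
    have : (fun k => tl x (n + k)) = fun k => x (n + 1 + k) := by
      funext k
      rw [tl_apply]
      congr 1
      omega
    rwa [Set.mem_ofPred_eq, this]

/-- Density comes from the hung trees alone, so `Z` need only be countable. Deleting a finite
initial segment is finite-to-one, which gives countability. -/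
theorem Admissible.ramify {Z : Set Branch} (hZ : Z.Countable) {W : ℕ → Bool → Branch → ℕ}
    (hW : ∀ n i, Admissible (W n i)) : Admissible (ramify Z W) where
  countable := by
    classical
    refine ((hZ.image spine).union (Set.countable_iUnion fun n => Set.countable_iUnion fun i =>
      countable_drop (hW n i).countable (2 * n + 2))).mono fun x hx => ?_
    rw [Set.mem_ofPred_eq] at hx
    rcases exists_spine_or x with ⟨z, rfl⟩ | h
    · refine Or.inl ⟨z, ?_, rfl⟩
      by_contra hz
      rw [ramify_spine, if_neg hz] at hx
      exact hx rfl
    · rw [RefBin.ramify, dif_pos h] at hx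
      exact Or.inr (Set.mem_iUnion.2 ⟨_, Set.mem_iUnion.2 ⟨_, hx⟩⟩)
  dense n := by
    clear hZ
    induction n generalizing Z W with
    | zero =>
      intro x
      obtain ⟨y, hy, -⟩ := (hW 0 false).dense 0 x
      refine ⟨cons false (cons true y), ?_, fun k hk => absurd hk (by omega)⟩
      rw [ramify_eq]
      simpa [RefBin.join] using hy
    | succ n ih =>
      intro x
      rcases hx : x 1 with _ | _
      · obtain ⟨y, hy, hag⟩ := ih (Z := above Z (x 0)) (W := fun n => W (n + 1))
          (fun n i => hW (n + 1) i) (tl (tl x))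
        refine ⟨cons (x 0) (cons false y), ?_, ?_⟩
        · rw [ramify_eq]
          simpa [RefBin.join] using hy
        · refine Agree.mono (Nat.le_succ (n + 1)) (agree_succ.2 ⟨rfl, agree_succ.2 ⟨?_, hag⟩⟩)
          simp [hx]
      · obtain ⟨y, hy, hag⟩ := (hW 0 (x 0)).dense n (tl (tl x))
        refine ⟨cons (x 0) (cons true y), ?_, ?_⟩
        · rw [ramify_eq]
          simpa [RefBin.join] using hy
        · refine Agree.mono (Nat.le_succ (n + 1)) (agree_succ.2 ⟨rfl, agree_succ.2 ⟨?_, hag⟩⟩)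
          simp [hx]

/-- The branches which are eventually constant with value `i`. -/
def eventually (i : Bool) : Set Branch := {z | ∃ n, ∀ k, z (n + k) = i}

theorem countable_eventually (i : Bool) : (eventually i).Countable := by
  have : eventually i = ⋃ n, {x : Branch | (fun k => x (n + k)) ∈ ({fun _ => i} : Set Branch)} := by
    ext z
    simp [eventually, funext_iff]
  rw [this]
  exact Set.countable_iUnion fun n => countable_drop (Set.countable_singleton _) n

theorem dense_eventually (i : Bool) : DenseSet (eventually i) := fun x n =>
  ⟨fun k => if k < n then x k else i, ⟨n, fun k => by simp⟩, fun k hk => if_pos hk⟩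

open Classical in
/-- The coloured tree in which the eventually vanishing branches have multiplicity `c`. -/
noncomputable def uniform (c : ℕ) : Branch → ℕ := fun x => if x ∈ eventually false then c else 0

theorem admissible_uniform {c : ℕ} (hc : c ≠ 0) : Admissible (uniform c) where
  countable := (countable_eventually false).mono fun x hx => by
    by_contra h
    simp [uniform, h] at hx
  dense n x := by
    obtain ⟨y, hy, hag⟩ := dense_eventually false x n
    exact ⟨y, by simpa [uniform, hy] using hc, hag⟩

/-- A countable nonzero ordinal has a sequence of smaller ordinals which is eventually above each
smaller ordinal. -/
theorem exists_cofinal_sequence {α : Ordinal.{0}} (hα : α < ω_ 1) (h0 : α ≠ 0) :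
    ∃ s : ℕ → Ordinal.{0}, (∀ n, s n < α) ∧ ∀ γ < α, ∃ N, ∀ n ≥ N, γ ≤ s n := by
  have hc : (Set.Iio α).Countable := by
    rw [← Cardinal.le_aleph0_iff_set_countable, Cardinal.mk_Iio_ordinal, Cardinal.lift_le_aleph0,
      ← Cardinal.lt_aleph_one_iff, ← Cardinal.lt_ord, Cardinal.ord_aleph]
    exact hα
  obtain ⟨f, hf⟩ := hc.exists_eq_range ⟨0, pos_iff_ne_zero.2 h0⟩
  have hlt : ∀ n, f n < α := fun n => by
    have : f n ∈ Set.Iio α := hf ▸ Set.mem_range_self n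
    exact this
  -- Finite maxima of an enumeration stay below `α`, also when `α` is a successor, and they
  -- increase.
  refine ⟨fun n => (Finset.range (n + 1)).sup' ⟨0, by simp⟩ f, fun n => ?_, fun γ hγ => ?_⟩
  · exact (Finset.sup'_lt_iff _).2 fun i _ => hlt i
  · have : γ ∈ Set.range f := hf ▸ hγ
    obtain ⟨k, rfl⟩ := this
    exact ⟨k, fun n hn => Finset.le_sup' f (Finset.mem_range.2 (by omega))⟩

/-- At every countable level there are two admissible coloured trees which are equivalent at that
level but not isomorphic. -/
theorem exists_sim_not_isEmb {α : Ordinal.{0}} (hα : α < ω_ 1) :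
    ∃ P Q : Branch → ℕ, Admissible P ∧ Admissible Q ∧ (∃ x, P x = 2) ∧
      (∀ φ, ¬ IsEmb φ P Q) ∧ Sim α P Q := by
  induction α using WellFoundedLT.induction with
  | _ α ih =>
    have hz : (fun _ => false) ∈ eventually false := ⟨0, fun _ => rfl⟩
    have hA : ∀ x, uniform 1 x ≠ 2 := fun x => by
      unfold uniform
      split_ifs <;> norm_num
    rcases eq_or_ne α 0 with rfl | h0
    · have hP : uniform 2 (fun _ => false) = 2 := if_pos hz
      -- At level 0 equivalence is vacuous, and a multiplicity 2 occurs in only one of the trees.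
      -- The clause on multiplicity 2 is carried along because `hang` uses it as a marker.
      refine ⟨uniform 2, uniform 1, admissible_uniform (by norm_num),
        admissible_uniform (by norm_num), ⟨_, hP⟩, fun φ h => hA _ ((h.map_eq _).trans hP), ?_⟩
      rw [Sim]
      exact fun β hβ => absurd hβ not_lt_zero
    · obtain ⟨s, hs, hcof⟩ := exists_cofinal_sequence hα h0
      choose P Q hP hQ hP2 hPQ hsim using fun n => ih (s n) (hs n) ((hs n).trans hα)
      let W : ℕ → Bool → Branch → ℕ := fun n i => if i then Q n else P n
      have hW : ∀ n i, Admissible (hang (uniform 1) (W n i)) := by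
        refine fun n i => Admissible.join fun j => ?_
        cases j
        · exact admissible_uniform one_ne_zero
        · cases i
          · exact hP n
          · exact hQ n
      have hWs : ∀ n i i', Sim (s n) (hang (uniform 1) (W n i)) (hang (uniform 1) (W n i')) := by
        refine fun n i i' => Sim.join fun j => ?_
        cases j
        · exact Sim.refl _ _
        · cases i <;> cases i'
          · exact Sim.refl _ _
          · exact hsim n
          · exact (hsim n).symm
          · exact Sim.refl _ _
      refine ⟨ramify (eventually false) fun n i => hang (uniform 1) (W n i),
        ramify (eventually true) fun n i => hang (uniform 1) (W n i),
        Admissible.ramify (countable_eventually _) hW,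
        Admissible.ramify (countable_eventually _) hW,
        exists_ramify_eq_two (dense_eventually _) _, ?_, ?_⟩
      -- The constant branch `false` belongs to one of the dense sets and not to the other.
      · refine not_isEmb_ramify hA hP2 hPQ (dense_eventually _) (dense_eventually _) hz ?_
        rintro ⟨n, hn⟩
        exact absurd (hn 0) (by simp)
      · refine sim_ramify (W := fun n i => hang (uniform 1) (W n i)) (fun γ hγ => ?_) 0 _ _
          (dense_eventually _) (dense_eventually _)
        obtain ⟨N, hN⟩ := hcof γ hγ
        exact ⟨N, fun n hn i i' => (hWs n i i').mono (hN n hn)⟩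

end RefBin

/-! ### Models from dense maps into the Cantor space. -/

namespace RefBin

open FirstOrder CountableModels Ordinal

/-- The interpretation of the relation symbols given by a map from `ℕ` to the branches. -/
def relOfMap (f : ℕ → Branch) : ∀ {n : ℕ}, Rel n → (Fin n → ℕ) → Prop
  | _, Rel.E n, v => Agree n (f (v 0)) (f (v 1))

/-- The structure on `ℕ` in which `E n i j` holds if `f i` and `f j` agree in the first `n`
bits. -/
def ofMap (f : ℕ → Branch) : StructureSpace lang where
  funMap := fun F _ => Empty.elim F
  RelMap := fun R v => relOfMap f R v

/-- Every basic open set of branches contains a value of `f`. -/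
def DenseMap (f : ℕ → Branch) : Prop := ∀ n x, ∃ k, Agree n (f k) x

instance : lang.IsRelational := fun _ => inferInstanceAs (IsEmpty Empty)

instance (n : ℕ) : Countable (lang.Relations n) := by
  refine Function.Injective.countable (f := fun R : Rel n => (match R with | .E k => k : ℕ)) ?_
  rintro ⟨a⟩ R h
  cases R with
  | E b => exact congrArg Rel.E h

theorem turn_agree (x : Branch) (n : ℕ) (w : Branch) : Agree n (turn x n w) x :=
  fun _ hk => if_pos hk

theorem turn_apply_self (x : Branch) (n : ℕ) (w : Branch) : turn x n w n = !x n := by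
  simp [turn]

theorem bool_eq_of_ne_of_ne {a b c : Bool} (h : a ≠ c) (h' : b ≠ c) : a = b := by
  revert a b c; decide

/-- Density supplies a point turning away at level `n`; there are exactly two classes because bits
take two values. -/
theorem ofMap_mem_modelSpace {f : ℕ → Branch} (hf : DenseMap f) :
    ofMap f ∈ ModelSpace REFbin := by
  let M : lang.Structure ℕ := ofMap f
  have hR : ∀ n (v : Fin 2 → ℕ),
      @FirstOrder.Language.Structure.RelMap lang ℕ M 2 (sym n) v ↔
        Agree n (f (v 0)) (f (v 1)) := fun _ _ => Iff.rfl
  refine @FirstOrder.Language.Theory.Model.mk lang ℕ M REFbin fun φ hφ => ?_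
  rcases hφ with ((((⟨n, rfl⟩ | ⟨n, rfl⟩) | ⟨n, rfl⟩) | rfl) | ⟨n, rfl⟩) | ⟨n, rfl⟩
  · rw [FirstOrder.Language.Relations.realize_reflexive]
    exact ⟨fun x => Agree.refl n (f x)⟩
  · rw [FirstOrder.Language.Relations.realize_symmetric]
    exact ⟨fun x y h => Agree.symm (x := f x) (y := f y) h⟩
  · rw [FirstOrder.Language.Relations.realize_transitive]
    exact ⟨fun x y z h h' => Agree.trans (x := f x) (y := f y) (z := f z) h h'⟩
  · simp [trivialAxiom, atom, FirstOrder.Language.Sentence.Realize,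
      FirstOrder.Language.Formula.Realize, hR, Fin.snoc,
      FirstOrder.Language.BoundedFormula.realize_rel₂, Agree]
  · simp only [refineAxiom, atom, FirstOrder.Language.Sentence.Realize,
      FirstOrder.Language.Formula.Realize, FirstOrder.Language.BoundedFormula.realize_all,
      FirstOrder.Language.BoundedFormula.realize_imp,
      FirstOrder.Language.BoundedFormula.realize_rel₂, hR]
    exact fun x y h => Agree.mono n.le_succ h
  · simp only [splitAxiom, atom, FirstOrder.Language.Sentence.Realize,
      FirstOrder.Language.Formula.Realize, FirstOrder.Language.BoundedFormula.realize_all,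
      FirstOrder.Language.BoundedFormula.realize_ex,
      FirstOrder.Language.BoundedFormula.realize_inf,
      FirstOrder.Language.BoundedFormula.realize_sup,
      FirstOrder.Language.BoundedFormula.realize_not,
      FirstOrder.Language.BoundedFormula.realize_imp,
      FirstOrder.Language.BoundedFormula.realize_rel₂, hR]
    intro x
    obtain ⟨y, hy⟩ := hf (n + 1) (turn (f x) n (f x))
    have hyn := hy n n.lt_succ_self
    rw [turn_apply_self] at hyn
    have hxy : Agree n (f x) (f y) := ((hy.mono n.le_succ).trans (turn_agree _ _ _)).symm
    refine ⟨y, hxy, fun h => ?_, fun z hz => ?_⟩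
    · have : f x n = f y n := h n n.lt_succ_self
      simp [hyn] at this
    · have hz : Agree n (f x) (f z) := hz
      by_cases h : f x n = f z n
      · exact Or.inl (agree_succ_last.2 ⟨hz, h⟩)
      · refine Or.inr (agree_succ_last.2 ⟨hxy.symm.trans hz, ?_⟩)
        show f y n = f z n
        rw [hyn]
        revert h
        cases f x n <;> cases f z n <;> simp

/-! ### One-point extensions of splitting patterns. -/

section Extension

variable {ι : Type*} {x y : ι → Branch} {c d : Branch}

theorem exists_last_agree [Nonempty ι] {N : ℕ} (h : ∀ i, ¬ Agree N c (x i)) :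
    ∃ n < N, ∃ i, Agree n c (x i) ∧ ∀ j, ¬ Agree (n + 1) c (x j) := by
  induction N with
  | zero => exact absurd (fun k hk => absurd hk (by omega)) (h (Classical.arbitrary ι))
  | succ N ih =>
    by_cases h' : ∃ i, Agree N c (x i)
    · obtain ⟨i, hi⟩ := h'
      exact ⟨N, N.lt_succ_self, i, hi, h⟩
    · push Not at h'
      obtain ⟨n, hn, H⟩ := ih h'
      exact ⟨n, hn.trans N.lt_succ_self, H⟩

/-- Where `c` leaves `x i` at level `n`, no `x j` goes along with it. As branching is binary, every
`y j` through that vertex must continue with `y i`, so `d` leaves them all. -/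
theorem agree_iff_of_turn {n N : ℕ} {i : ι}
    (H : ∀ k ≤ N, ∀ i j, Agree k (x i) (x j) ↔ Agree k (y i) (y j)) (hn : n < N)
    (hc : Agree n c (x i)) (hc' : ∀ j, ¬ Agree (n + 1) c (x j)) (hd : Agree n d (y i))
    (hd' : d n ≠ y i n) : ∀ k ≤ N, ∀ j, Agree k c (x j) ↔ Agree k d (y j) := by
  intro k hk j
  rcases le_or_gt k n with hkn | hkn
  · have h1 : Agree k c (x j) ↔ Agree k (x i) (x j) :=
      ⟨fun h => (hc.mono hkn).symm.trans h, fun h => (hc.mono hkn).trans h⟩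
    have h2 : Agree k d (y j) ↔ Agree k (y i) (y j) :=
      ⟨fun h => (hd.mono hkn).symm.trans h, fun h => (hd.mono hkn).trans h⟩
    rw [h1, h2, H k hk]
  · refine iff_of_false (fun h => hc' j (h.mono hkn)) fun h => ?_
    have h := agree_succ_last.1 (h.mono (show n + 1 ≤ k from hkn))
    have h1 : Agree n (x i) (x j) := (H n hn.le i j).2 (hd.symm.trans h.1)
    have h2 : ¬ Agree (n + 1) (x i) (x j) := fun h3 =>
      hd' (h.2.trans ((H (n + 1) hn i j).1 h3 n n.lt_succ_self).symm)
    have h3 : x i n ≠ x j n := fun h3 => h2 (agree_succ_last.2 ⟨h1, h3⟩)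
    have h4 : c n ≠ x i n := fun h4 => hc' i (agree_succ_last.2 ⟨hc, h4⟩)
    exact hc' j (agree_succ_last.2 ⟨hc.trans h1, bool_eq_of_ne_of_ne h4 h3.symm⟩)

theorem exists_agree_extension {N : ℕ}
    (H : ∀ k ≤ N, ∀ i j, Agree k (x i) (x j) ↔ Agree k (y i) (y j)) (c : Branch) :
    ∃ d, ∀ k ≤ N, ∀ j, Agree k c (x j) ↔ Agree k d (y j) := by
  by_cases h : ∃ i, Agree N c (x i)
  · obtain ⟨i, hi⟩ := h
    refine ⟨y i, fun k hk j => ?_⟩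
    rw [← H k hk]
    exact ⟨fun h => (hi.mono hk).symm.trans h, fun h => (hi.mono hk).trans h⟩
  · push Not at h
    rcases isEmpty_or_nonempty ι with hι | hι
    · exact ⟨c, fun k hk j => hι.elim j⟩
    · obtain ⟨n, hn, i, hi, hi'⟩ := exists_last_agree h
      refine ⟨turn (y i) n c, agree_iff_of_turn H hn hi hi' (turn_agree _ _ _) ?_⟩
      rw [turn_apply_self]
      simp

end Extension

/-! ### Quantifier elimination. -/

section Elementary

variable {f g : ℕ → Branch}

/-- Each basic open set of branches contains values of `f` at infinitely many places. -/
theorem DenseMap.exists_ne (hf : DenseMap f) {ι : Type*} [Finite ι] (b : ι → ℕ) (n : ℕ)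
    (x : Branch) : ∃ k, Agree n (f k) x ∧ ∀ i, k ≠ b i := by
  obtain ⟨N, ⟨r⟩⟩ := Finite.exists_equiv_fin ι
  -- Diagonalisation: bit `n + r i` is made to differ from that of `f (b i)`.
  let y : Branch := fun k => if k < n then x k else
    if h : k - n < N then !f (b (r.symm ⟨k - n, h⟩)) k else false
  obtain ⟨k, hk⟩ := hf (n + N) y
  refine ⟨k, (hk.mono (Nat.le_add_right _ _)).trans fun j hj => if_pos hj, ?_⟩
  rintro i rfl
  have h := hk (n + r i) (by simp)
  simp [y] at h

/-- The maps `a` and `b` agree in the language with equality and `E 0, …, E N`. -/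
def SameType (N : ℕ) (f g : ℕ → Branch) {ι : Type*} (a b : ι → ℕ) : Prop :=
  (∀ i j, a i = a j ↔ b i = b j) ∧
    ∀ k ≤ N, ∀ i j, Agree k (f (a i)) (f (a j)) ↔ Agree k (g (b i)) (g (b j))

theorem SameType.symm {N : ℕ} {ι : Type*} {a b : ι → ℕ} (h : SameType N f g a b) :
    SameType N g f b a :=
  ⟨fun i j => (h.1 i j).symm, fun k hk i j => (h.2 k hk i j).symm⟩

theorem SameType.exists_extension {N : ℕ} {ι : Type*} [Finite ι] {a b : ι → ℕ}
    (h : SameType N f g a b) (hg : DenseMap g) (c : ℕ) :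
    ∃ d, (∀ i, c = a i ↔ d = b i) ∧
      ∀ k ≤ N, ∀ i, Agree k (f c) (f (a i)) ↔ Agree k (g d) (g (b i)) := by
  by_cases hc : ∃ i, c = a i
  · obtain ⟨i, rfl⟩ := hc
    exact ⟨b i, fun j => h.1 i j, fun k hk j => h.2 k hk i j⟩
  · push Not at hc
    obtain ⟨y, hy⟩ := exists_agree_extension (x := fun i => f (a i))
      (y := fun i => g (b i)) h.2 (f c)
    obtain ⟨d, hd, hd'⟩ := hg.exists_ne b N y
    refine ⟨d, fun i => iff_of_false (hc i) (hd' i), fun k hk i => ?_⟩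
    rw [hy k hk i]
    exact ⟨fun h => (hd.mono hk).trans h, fun h => (hd.mono hk).symm.trans h⟩

theorem SameType.snoc {N n k : ℕ} {v v' : Fin n → ℕ} {xs xs' : Fin k → ℕ}
    (h : SameType N f g (Sum.elim v xs) (Sum.elim v' xs')) {c d : ℕ}
    (h1 : ∀ i, c = Sum.elim v xs i ↔ d = Sum.elim v' xs' i)
    (h2 : ∀ k ≤ N, ∀ i, Agree k (f c) (f (Sum.elim v xs i)) ↔
      Agree k (g d) (g (Sum.elim v' xs' i))) :
    SameType N f g (Sum.elim v (Fin.snoc xs c : Fin (k + 1) → ℕ))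
      (Sum.elim v' (Fin.snoc xs' d : Fin (k + 1) → ℕ)) := by
  have key : ∀ p : Fin n ⊕ Fin (k + 1),
      (Sum.elim v (Fin.snoc xs c : Fin (k + 1) → ℕ) p = c ∧
        Sum.elim v' (Fin.snoc xs' d : Fin (k + 1) → ℕ) p = d) ∨
      ∃ q, Sum.elim v (Fin.snoc xs c : Fin (k + 1) → ℕ) p = Sum.elim v xs q ∧
        Sum.elim v' (Fin.snoc xs' d : Fin (k + 1) → ℕ) p = Sum.elim v' xs' q := by
    rintro (i | i)
    · exact Or.inr ⟨Sum.inl i, rfl, rfl⟩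
    · refine Fin.lastCases (Or.inl (by simp)) (fun i => Or.inr ⟨Sum.inr i, by simp⟩) i
  have swap : ∀ {A : Type} {k : ℕ} {x y : ℕ → A}, Agree k x y ↔ Agree k y x :=
    ⟨Agree.symm, Agree.symm⟩
  refine ⟨fun p q => ?_, fun l hl p q => ?_⟩
  · rcases key p with ⟨e1, e2⟩ | ⟨p', e1, e2⟩ <;> rcases key q with ⟨e3, e4⟩ | ⟨q', e3, e4⟩ <;>
      rw [e1, e2, e3, e4]
    · simp
    · exact h1 q'
    · rw [eq_comm, h1 p', eq_comm]
    · exact h.1 p' q'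
  · rcases key p with ⟨e1, e2⟩ | ⟨p', e1, e2⟩ <;> rcases key q with ⟨e3, e4⟩ | ⟨q', e3, e4⟩ <;>
      rw [e1, e2, e3, e4]
    · simp [Agree]
    · exact h2 l hl q'
    · rw [swap, h2 l hl p', swap]
    · exact h.2 l hl p' q'

theorem exists_eq_var {α : Type*} (t : lang.Term α) : ∃ i, t = FirstOrder.Language.Term.var i := by
  cases t with
  | var i => exact ⟨i, rfl⟩
  | func F _ => exact Empty.elim F

/-- The truth of a formula depends only on finitely many of the relations between the
parameters. -/
theorem exists_realize_iff {n k : ℕ} (φ : lang.BoundedFormula (Fin n) k) :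
    ∃ N, ∀ f g : ℕ → Branch, DenseMap f → DenseMap g → ∀ v v' xs xs',
      SameType N f g (Sum.elim v xs) (Sum.elim v' xs') →
        (@FirstOrder.Language.BoundedFormula.Realize lang ℕ (ofMap f) _ _ φ v xs ↔
          @FirstOrder.Language.BoundedFormula.Realize lang ℕ (ofMap g) _ _ φ v' xs') := by
  induction φ with
  | falsum => exact ⟨0, fun _ _ _ _ _ _ _ _ _ => Iff.rfl⟩
  | equal t₁ t₂ =>
    obtain ⟨i, rfl⟩ := exists_eq_var t₁
    obtain ⟨j, rfl⟩ := exists_eq_var t₂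
    exact ⟨0, fun f g _ _ v v' xs xs' h => h.1 i j⟩
  | rel R ts =>
    cases R with
    | E m =>
      obtain ⟨i, hi⟩ := exists_eq_var (ts 0)
      obtain ⟨j, hj⟩ := exists_eq_var (ts 1)
      refine ⟨m, fun f g _ _ v v' xs xs' h => ?_⟩
      have := h.2 m le_rfl i j
      show Agree m (f (@FirstOrder.Language.Term.realize lang ℕ (ofMap f) _ _ (ts 0)))
          (f (@FirstOrder.Language.Term.realize lang ℕ (ofMap f) _ _ (ts 1))) ↔
        Agree m (g (@FirstOrder.Language.Term.realize lang ℕ (ofMap g) _ _ (ts 0)))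
          (g (@FirstOrder.Language.Term.realize lang ℕ (ofMap g) _ _ (ts 1)))
      rw [hi, hj]
      exact this
  | imp φ ψ ihφ ihψ =>
    obtain ⟨N₁, h₁⟩ := ihφ
    obtain ⟨N₂, h₂⟩ := ihψ
    refine ⟨max N₁ N₂, fun f g hf hg v v' xs xs' h => ?_⟩
    exact imp_congr
      (h₁ f g hf hg v v' xs xs' ⟨h.1, fun k hk => h.2 k (hk.trans (le_max_left _ _))⟩)
      (h₂ f g hf hg v v' xs xs' ⟨h.1, fun k hk => h.2 k (hk.trans (le_max_right _ _))⟩)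
  | all φ ih =>
    obtain ⟨N, hN⟩ := ih
    -- A quantifier does not raise `N`: every pattern is realised by a new point, so equality costs
    -- nothing.
    refine ⟨N, fun f g hf hg v v' xs xs' h => ⟨fun H d => ?_, fun H c => ?_⟩⟩
    · obtain ⟨c, h1, h2⟩ := h.symm.exists_extension hf d
      exact (hN f g hf hg _ _ _ _ (h.symm.snoc h1 h2).symm).1 (H c)
    · obtain ⟨d, h1, h2⟩ := h.exists_extension hg c
      exact (hN f g hf hg _ _ _ _ (h.snoc h1 h2)).2 (H d)

theorem partialElementary_of_agree (hf : DenseMap f) (hg : DenseMap g) {n : ℕ} {a b : Fin n → ℕ}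
    (h1 : ∀ i j, a i = a j ↔ b i = b j)
    (h2 : ∀ k i j, Agree k (f (a i)) (f (a j)) ↔ Agree k (g (b i)) (g (b j))) :
    PartialElementary (ofMap f) (ofMap g) a b := by
  intro φ
  obtain ⟨N, hN⟩ := exists_realize_iff φ
  refine hN f g hf hg a b _ _ ⟨?_, ?_⟩
  · rintro (i | i) (j | j)
    · exact h1 i j
    all_goals first | exact i.elim0 | exact j.elim0
  · rintro k - (i | i) (j | j)
    · exact h2 k i j
    all_goals first | exact i.elim0 | exact j.elim0

end Elementary

/-! ### Good positions of the game. -/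

section Position

variable {m m' : Branch → ℕ}

theorem turn_turn_of_lt {x w v : Branch} {n k : ℕ} (h : k < n) :
    turn (turn x n w) k v = turn x k v := by
  funext l
  simp only [turn, h, if_true]
  split_ifs <;> first | rfl | omega

theorem turn_turn (x w v : Branch) (n k : ℕ) :
    turn (turn x n w) (n + 1 + k) v = turn x n (turn w k v) := by
  funext l
  simp only [turn]
  rcases lt_trichotomy l n with h | rfl | h
  · rw [if_pos (by omega), if_pos h, if_pos h]
  · rw [if_pos (by omega)]
    simp
  · obtain ⟨l, rfl⟩ := Nat.exists_eq_add_of_lt h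
    have e : n + l + 1 - n - 1 = l := by omega
    have e1 : ¬ n + l + 1 < n := by omega
    have e2 : ¬ n + l + 1 = n := by omega
    have e3 : n + l + 1 < n + 1 + k ↔ l < k := by omega
    have e4 : n + l + 1 = n + 1 + k ↔ l = k := by omega
    have e5 : ¬ n + 1 + k < n := by omega
    have e6 : ¬ n + 1 + k = n := by omega
    have e7 : n + 1 + k - n - 1 = k := by omega
    have e8 : n + l + 1 - (n + 1 + k) - 1 = l - k - 1 := by omega
    simp only [e, e1, e2, e3, e4, e5, e6, e7, e8, if_false]

theorem sib_turn_of_lt {x w : Branch} {n k : ℕ} (h : k < n) :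
    sib m (turn x n w) k = sib m x k := by
  funext v
  simp only [sib, turn_turn_of_lt h]

/-- The offset `n + 1` counts the common bits and the bit turned. -/
theorem sib_turn (x w : Branch) (n k : ℕ) :
    sib m (turn x n w) (n + 1 + k) = sib (sib m x n) w k := by
  funext v
  simp only [sib, turn_turn]

/-- A position of the game on coloured trees which is good for Player II: the chosen branches
correspond to each other, and so do all the parts of the trees which contain none of them. -/
structure Position (β : Ordinal.{0}) (m m' : Branch → ℕ) {n : ℕ} (x y : Fin n → Branch) :
    Prop where
  initial : n = 0 → Sim β m m'
  mult : ∀ i, m (x i) = m' (y i)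
  agree : ∀ k i j, Agree k (x i) (x j) ↔ Agree k (y i) (y j)
  sib : ∀ i k, (∀ j, Agree k (x j) (x i) → x j k = x i k) → Sim β (sib m (x i) k) (sib m' (y i) k)

theorem Position.symm {β : Ordinal.{0}} {n : ℕ} {x y : Fin n → Branch}
    (h : Position β m m' x y) : Position β m' m y x where
  initial := fun hn => (h.initial hn).symm
  mult := fun i => (h.mult i).symm
  agree := fun k i j => (h.agree k i j).symm
  sib := fun i k hik => by
    refine (h.sib i k fun j hj => ?_).symm
    have h1 := (h.agree k j i).1 hj
    exact ((h.agree (k + 1) j i).2 (agree_succ_last.2 ⟨h1, hik j h1⟩)) k k.lt_succ_self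

theorem snoc_agree {n : ℕ} {x y : Fin n → Branch} {c d : Branch}
    (H : ∀ k i j, Agree k (x i) (x j) ↔ Agree k (y i) (y j))
    (h : ∀ k j, Agree k c (x j) ↔ Agree k d (y j)) (k : ℕ) (i j : Fin (n + 1)) :
    Agree k ((Fin.snoc x c : Fin (n + 1) → Branch) i) ((Fin.snoc x c : Fin (n + 1) → Branch) j) ↔
      Agree k ((Fin.snoc y d : Fin (n + 1) → Branch) i)
        ((Fin.snoc y d : Fin (n + 1) → Branch) j) := by
  refine Fin.lastCases ?_ (fun i => ?_) i <;> refine Fin.lastCases ?_ (fun j => ?_) j <;>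
    simp only [Fin.snoc_last, Fin.snoc_castSucc]
  · exact iff_of_true (Agree.refl _ _) (Agree.refl _ _)
  · exact h k j
  · exact ⟨fun h' => ((h k i).1 h'.symm).symm, fun h' => ((h k i).2 h'.symm).symm⟩
  · exact H k i j

theorem Position.snoc {β γ : Ordinal.{0}} (hγ : γ < β) {n : ℕ} {x y : Fin n → Branch}
    (h : Position β m m' x y) {c d : Branch} (hm : m' d = m c)
    (hag : ∀ k j, Agree k c (x j) ↔ Agree k d (y j))
    (hs : ∀ k, (∀ j, Agree k (x j) c → x j k = c k) →
      Sim γ (RefBin.sib m c k) (RefBin.sib m' d k)) :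
    Position γ m m' (Fin.snoc x c : Fin (n + 1) → Branch)
      (Fin.snoc y d : Fin (n + 1) → Branch) where
  initial := fun h => absurd h n.succ_ne_zero
  mult := fun i => by
    refine Fin.lastCases ?_ (fun i => ?_) i
    · simpa using hm.symm
    · simpa using h.mult i
  agree := snoc_agree h.agree hag
  sib := fun i k => by
    refine Fin.lastCases ?_ (fun i => ?_) i <;> simp only [Fin.snoc_last, Fin.snoc_castSucc] <;>
      intro H
    · exact hs k fun j => by simpa using H j.castSucc
    · exact (h.sib i k fun j => by simpa using H j.castSucc).mono hγ.le

/-- A new branch leaves the chosen ones at a last level `n₀`, and so lies in a sibling tree of some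
`x i` which contains no chosen branch. The equivalence of this tree with its counterpart gives the
answer. At the empty position the whole trees play this role. -/
theorem Position.forth {β γ : Ordinal.{0}} (hγ : γ < β) {n : ℕ} {x y : Fin n → Branch}
    (h : Position β m m' x y) {c : Branch} (hc : m c ≠ 0) :
    ∃ d, m' d = m c ∧
      Position γ m m' (Fin.snoc x c : Fin (n + 1) → Branch)
        (Fin.snoc y d : Fin (n + 1) → Branch) := by
  rcases Nat.eq_zero_or_pos n with rfl | hn
  · have h0 := h.initial rfl
    rw [Sim] at h0
    obtain ⟨d, hd, hs⟩ := (h0 γ hγ).1 c hc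
    exact ⟨d, hd, h.snoc hγ hd (fun k j => j.elim0) fun k _ => hs k⟩
  · have : Nonempty (Fin n) := ⟨⟨0, hn⟩⟩
    by_cases hcx : ∃ i, c = x i
    · obtain ⟨i, rfl⟩ := hcx
      exact ⟨y i, (h.mult i).symm, h.snoc hγ (h.mult i).symm (fun k j => h.agree k i j)
        fun k H => (h.sib i k H).mono hγ.le⟩
    · push Not at hcx
      have hN : ∀ i, ∃ N, c N ≠ x i N := fun i => Function.ne_iff.1 (hcx i)
      choose N hN using hN
      obtain ⟨n₀, -, i, hi, hi'⟩ := exists_last_agree (c := c) (x := x)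
        (N := Finset.univ.sup N + 1) fun i hag =>
          hN i (hag _ (Nat.lt_succ_iff.2 (Finset.le_sup (Finset.mem_univ i))))
      have hne : ∀ j, Agree n₀ c (x j) → x j n₀ ≠ c n₀ := fun j hj h' =>
        hi' j (agree_succ_last.2 ⟨hj, h'.symm⟩)
      have hs := h.sib i n₀ fun j hj =>
        bool_eq_of_ne_of_ne (hne j (hi.trans hj.symm)) (hne i hi)
      have hcw : c = turn (x i) n₀ fun k => c (n₀ + 1 + k) := by
        funext k
        rcases lt_trichotomy k n₀ with hk | rfl | hk
        · rw [turn_agree _ _ _ k hk, hi k hk]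
        · rw [turn_apply_self]
          exact bool_eq_of_ne_of_ne (hne i hi).symm (by simp)
        · simp only [turn, hk.not_gt, hk.ne', if_false]
          congr 1
          omega
      rw [Sim] at hs
      generalize (fun k => c (n₀ + 1 + k)) = w at hcw
      subst hcw
      obtain ⟨w', hw', hsib⟩ := (hs γ hγ).1 w hc
      refine ⟨turn (y i) n₀ w', hw', h.snoc hγ hw' (fun k j => ?_) fun k H => ?_⟩
      · refine agree_iff_of_turn (N := max k (n₀ + 1)) (fun k _ => h.agree k)
          (lt_max_of_lt_right n₀.lt_succ_self) hi hi' (turn_agree _ _ _) ?_ k (le_max_left _ _) j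
        rw [turn_apply_self]
        simp
      -- Below `n₀` the siblings are those of `x i`, and above they are siblings inside the subtree.
      -- At `n₀` the sibling contains `x i`, so nothing is required.
      · rcases lt_trichotomy k n₀ with hk | rfl | hk
        · rw [sib_turn_of_lt hk, sib_turn_of_lt hk]
          refine (h.sib i k fun j hj => ?_).mono hγ.le
          rw [H j (hj.trans (hi.mono hk.le).symm), hi k hk]
        · exact absurd (H i hi.symm) (hne i hi)
        · obtain ⟨k, rfl⟩ := Nat.exists_eq_add_of_lt hk
          rw [show n₀ + k + 1 = n₀ + 1 + k by omega, sib_turn, sib_turn]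
          exact hsib k

end Position

/-! ### From coloured trees to models. -/

section Model

variable {m m' : Branch → ℕ}

/-- The points of a coloured tree: its branches, repeated according to their multiplicities. -/
abbrev Point (m : Branch → ℕ) : Type := {p : Branch × ℕ // p.2 < m p.1}

theorem Admissible.nonempty_equiv (h : Admissible m) : Nonempty (ℕ ≃ Point m) := by
  have hc : Countable (Point m) := by
    refine Set.Countable.to_subtype (s := {p : Branch × ℕ | p.2 < m p.1}) ?_
    refine (h.countable.prod Set.countable_univ).mono fun p hp => Set.mk_mem_prod ?_ (Set.mem_univ _)
    exact Nat.ne_zero_of_lt (show p.2 < m p.1 from hp)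
  have hi : Infinite (Point m) := by
    -- The prefixes `0ⁿ1` are pairwise incompatible and give infinitely many branches.
    choose y hy hag using fun n : ℕ => h.dense (n + 1) fun k => decide (k = n)
    refine Infinite.of_injective
      (fun n => (⟨(y n, 0), Nat.pos_of_ne_zero (hy n)⟩ : Point m)) fun a b hab => ?_
    have hab : y a = y b := congrArg (fun p : Point m => p.1.1) hab
    have key : ∀ a b, a < b → y a ≠ y b := fun a b hlt hab => by
      have h1 := hag a a (by omega)
      have h2 := hag b a (by omega)
      rw [hab, h2] at h1
      simp [hlt.ne] at h1
    rcases lt_trichotomy a b with hlt | heq | hlt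
    · exact absurd hab (key a b hlt)
    · exact heq
    · exact absurd hab.symm (key b a hlt)
  obtain ⟨_⟩ := nonempty_denumerable (Point m)
  exact ⟨(Denumerable.eqv (Point m)).symm⟩

/-- The branch of a point. -/
def proj (e : ℕ ≃ Point m) (k : ℕ) : Branch := (e k).1.1

theorem Admissible.denseMap (h : Admissible m) (e : ℕ ≃ Point m) : DenseMap (proj e) := by
  intro n x
  obtain ⟨y, hy, hag⟩ := h.dense n x
  refine ⟨e.symm ⟨(y, 0), Nat.pos_of_ne_zero hy⟩, ?_⟩
  simpa [proj] using hag

theorem proj_comp_snoc (e : ℕ ≃ Point m) {n : ℕ} (a : Fin n → ℕ) (c : ℕ) :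
    proj e ∘ (Fin.snoc a c : Fin (n + 1) → ℕ) = Fin.snoc (proj e ∘ a) (proj e c) :=
  Fin.comp_snoc _ _ _

/-- The answer is the copy with the same index on the answering branch; it exists because the
multiplicities agree. Equal indices make equality of points correspond on both sides. -/
theorem Position.exists_point {γ : Ordinal.{0}} {e : ℕ ≃ Point m} {e' : ℕ ≃ Point m'}
    {β : Ordinal.{0}} (hγ : γ < β) {n : ℕ} {a b : Fin n → ℕ}
    (h : Position β m m' (proj e ∘ a) (proj e' ∘ b)) (hab : ∀ i, (e (a i)).1.2 = (e' (b i)).1.2)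
    (c : ℕ) : ∃ d, Position γ m m' (proj e ∘ (Fin.snoc a c : Fin (n + 1) → ℕ))
      (proj e' ∘ (Fin.snoc b d : Fin (n + 1) → ℕ)) ∧
      ∀ i, (e ((Fin.snoc a c : Fin (n + 1) → ℕ) i)).1.2 =
        (e' ((Fin.snoc b d : Fin (n + 1) → ℕ) i)).1.2 := by
  have hc := (e c).2
  obtain ⟨d, hd, hpos⟩ := h.forth hγ (c := proj e c) (Nat.ne_zero_of_lt hc)
  refine ⟨e'.symm ⟨(d, (e c).1.2), hd ▸ hc⟩, ?_, fun i => ?_⟩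
  · rw [proj_comp_snoc, proj_comp_snoc]
    simpa [proj] using hpos
  · refine Fin.lastCases ?_ (fun i => ?_) i
    · simp
    · simpa using hab i

theorem playerTwoWins_of_position (hm : Admissible m) (hm' : Admissible m') (e : ℕ ≃ Point m)
    (e' : ℕ ≃ Point m') {β : Ordinal.{0}} {n : ℕ} {a b : Fin n → ℕ}
    (h : Position β m m' (proj e ∘ a) (proj e' ∘ b))
    (hab : ∀ i, (e (a i)).1.2 = (e' (b i)).1.2) :
    PlayerTwoWins (ofMap (proj e)) (ofMap (proj e')) β a b := by
  induction β using WellFoundedLT.induction generalizing n with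
  | _ β ih =>
    have eq_iff : ∀ x y : Branch, x = y ↔ ∀ k, Agree k x y := fun x y =>
      ⟨fun h k => h ▸ Agree.refl k x, fun h => funext fun k => h (k + 1) k k.lt_succ_self⟩
    rw [PlayerTwoWins]
    refine ⟨partialElementary_of_agree (hm.denseMap e) (hm'.denseMap e') (fun i j => ?_) h.agree,
      fun γ hγ => ⟨fun c => ?_, fun d => ?_⟩⟩
    · rw [← e.injective.eq_iff, ← e'.injective.eq_iff, Subtype.ext_iff, Subtype.ext_iff,
        Prod.ext_iff, Prod.ext_iff, hab, hab, eq_iff, eq_iff]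
      exact and_congr (forall_congr' fun k => h.agree k i j) Iff.rfl
    · obtain ⟨d, h1, h2⟩ := h.exists_point hγ hab c
      exact ⟨d, ih γ hγ h1 h2⟩
    · obtain ⟨c, h1, h2⟩ := h.symm.exists_point hγ (fun i => (hab i).symm) d
      exact ⟨c, ih γ hγ h1.symm fun i => (h2 i).symm⟩

theorem Sim.equivUpTo {α : Ordinal.{0}} (h : Sim α m m') (hm : Admissible m)
    (hm' : Admissible m') (e : ℕ ≃ Point m) (e' : ℕ ≃ Point m') :
    EquivUpTo α (ofMap (proj e)) (ofMap (proj e')) :=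
  playerTwoWins_of_position hm hm' e e'
    ⟨fun _ => h, fun i => i.elim0, fun _ i => i.elim0, fun i => i.elim0⟩ fun i => i.elim0

theorem card_proj_fibre (e : ℕ ≃ Point m) (x : Branch) : Nat.card {k // proj e k = x} = m x := by
  have r : {k // proj e k = x} ≃ Fin (m x) :=
    { toFun := fun k => ⟨(e k.1).1.2, by
        have h1 := (e k.1).2
        have h2 : (e k.1).1.1 = x := k.2
        rwa [h2] at h1⟩
      invFun := fun l => ⟨e.symm ⟨(x, l), l.2⟩, by simp [proj]⟩
      left_inv := fun k => by
        have h2 : (e k.1).1.1 = x := k.2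
        apply Subtype.ext
        apply e.injective
        apply Subtype.ext
        simp [← h2]
      right_inv := fun l => by simp }
  rw [Nat.card_congr r, Nat.card_fin]

/-- The isomorphism is an isometry between the coded points and extends by density to all branches.
Multiplicities are sizes of fibres, which the isomorphism matches. -/
theorem exists_isEmb_of_iso (hm : Admissible m) (e : ℕ ≃ Point m)
    (e' : ℕ ≃ Point m') (h : Iso (ofMap (proj e)) (ofMap (proj e'))) : ∃ φ, IsEmb φ m m' := by
  set f := proj e with hf
  set g := proj e' with hg
  obtain ⟨s⟩ := h
  let σ : ℕ ≃ ℕ := @FirstOrder.Language.Equiv.toEquiv lang ℕ ℕ (ofMap f) (ofMap g) s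
  have hσ : ∀ n i j, Agree n (f i) (f j) ↔ Agree n (g (σ i)) (g (σ j)) := by
    intro n i j
    exact (@FirstOrder.Language.Equiv.map_rel' lang ℕ ℕ (ofMap f) (ofMap g) s 2 (sym n)
      ![i, j]).symm
  choose pick hpick using hm.denseMap e
  -- Bit `k` of the image is determined by any point sharing `k + 1` bits with `x`.
  let φ : Branch → Branch := fun x k => g (σ (pick (k + 1) x)) k
  have h1 : ∀ n i x, Agree n (f i) x → Agree n (g (σ i)) (φ x) := by
    intro n i x h k hk
    exact (hσ (k + 1) _ _).1 ((h.mono hk).trans (hpick (k + 1) x).symm) k k.lt_succ_self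
  have h2 : ∀ n x y, Agree n x y ↔ Agree n (φ x) (φ y) := by
    intro n x y
    have hx := hpick n x
    have hy := hpick n y
    have hx' := h1 n _ x hx
    have hy' := h1 n _ y hy
    constructor
    · intro h
      exact hx'.symm.trans (((hσ n _ _).1 ((hx.trans h).trans hy.symm)).trans hy')
    · intro h
      exact hx.symm.trans (((hσ n _ _).2 ((hx'.trans h).trans hy'.symm)).trans hy)
  have h3 : ∀ i, φ (f i) = g (σ i) := fun i => funext fun k =>
    (h1 (k + 1) i (f i) (Agree.refl _ _) k k.lt_succ_self).symm
  refine ⟨φ, h2, fun x => ?_⟩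
  rw [← card_proj_fibre e x, ← card_proj_fibre e' (φ x)]
  refine (Nat.card_congr (σ.subtypeEquiv fun k => ?_)).symm
  rw [← hf, ← hg, ← h3]
  refine ⟨fun h => by rw [h], fun h => funext fun l => ?_⟩
  exact (h2 (l + 1) (f k) x).2 (h ▸ Agree.refl _ _) l l.lt_succ_self

end Model

theorem exists_equivUpTo_not_iso {α : Ordinal.{0}} (hα : α < ω_ 1) :
    ∃ M ∈ ModelSpace REFbin, ∃ N ∈ ModelSpace REFbin, ¬ Iso M N ∧ EquivUpTo α M N := by
  obtain ⟨P, Q, hP, hQ, -, hne, hs⟩ := exists_sim_not_isEmb hα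
  obtain ⟨e⟩ := hP.nonempty_equiv
  obtain ⟨e'⟩ := hQ.nonempty_equiv
  refine ⟨_, ofMap_mem_modelSpace (hP.denseMap e), _, ofMap_mem_modelSpace (hQ.denseMap e'),
    fun h => ?_, hs.equivUpTo hP hQ e e'⟩
  obtain ⟨φ, hφ⟩ := exists_isEmb_of_iso hP e e' h
  exact hne φ hφ

end RefBin

/-! ### The theorem. -/

theorem mainTheorem6 :
    ¬ CountableModels.IsomorphismIsBorel RefBin.REFbin ∧
      ∀ α : Ordinal.{0}, α < Ordinal.omega 1 →
        ∃ M ∈ CountableModels.ModelSpace RefBin.REFbin, ∃ N ∈ CountableModels.ModelSpace RefBin.REFbin,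
          ¬ CountableModels.Iso M N ∧ CountableModels.EquivUpTo α M N := by
  refine ⟨fun h => ?_, fun α hα => RefBin.exists_equivUpTo_not_iso hα⟩
  obtain ⟨α, hα, H⟩ := h.exists_level
  obtain ⟨M, hM, N, hN, hMN, heq⟩ := RefBin.exists_equivUpTo_not_iso hα
  exact hMN (H M hM N hN heq)
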